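/- **Theorem (Stability).** *Setting.* Let $q\in(1,2]$, let $\Omega,\Sigma\subset\mathbb R^d$ be bounded, open and simply connected with $0\in\Sigma$, let $Y$ be a real Banach space, $A:L^q(\Omega)\to Y$ bounded and linear, $\lambda\in(0,\infty)$, $\nu\in(0,1)$, $s_{\mathcal R}=\nu/\min(\nu,1-\nu)$ and $s_{\mathcal G}=(1-\nu)/\min(\nu,1-\nu)$. For $W\subset\mathbb R^d$ open, $\mathcal M(W)$ denotes the dual of $C_0(W)$. For $\mu\in\mathcal M(W-\Sigma)$ and $g\in L^2(\Sigma)$, $\mu*g\in\mathcal M(W)$ is given by $\langle\mu*g,\varphi\rangle=\int_{W-\Sigma}\int_\Sigma\tilde\varphi(x+y)g(x)\,dx\,d\mu(y)$, where $\tilde\varphi$ is the extension of $\varphi\in C_0(W)$ by zero; for $W=\Omega$ it is identified with the unique function in $L^q(\Omega)$ that represents it. *Generative prior.* Let $L\ge1$, $N_0=1$, $N_1,\dots,N_L\in\mathbb N$, $\Omega^0=\Omega$, $\Omega^{l}=\Omega^{l-1}-\Sigma$, and let $E^l\subset\{1,\dots,N_l\}\times\{1,\dots,N_{l-1}\}$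 be such that each $n\in\{1,\dots,N_l\}$ occurs in some $(n,k)\in E^l$. Put $M^l=\mathcal M(\Omega^l)^{N_l}$, $M=M^1\times\dots\times M^L$, $\Theta=\prod_{l=1}^L L^2(\Sigma)^{E^l}$, $\mu^1*_1\theta^1=\sum_n\mu^1_n*\theta^1_{n,1}\in L^q(\Omega)$ and $\mu^l*_l\theta^l=\big(\sum_{n:(n,k)\in E^l}\mu^l_n*\theta^l_{n,k}\big)_{k}\in M^{l-1}$ for $l\ge 2$. Let $Z:\Theta\to\mathbb R^{N_c}$ be bounded and linear, and for $1\le l\le L-1$ let $\mathcal J_l:M^l\to[0,\infty]$ be sequentially weak* lower semicontinuous with $\mathcal J_l(0)=0$. For $v\in L^q(\Omega)$ let $$\mathcal G(v)=\inf\Big\{\sum_{l=1}^L\sum_{n=1}^{N_l}\|\mu^l_n\|_{\mathcal M}+\sum_{l=2}^L\mathcal J_{l-1}(\mu^{l-1}-\mu^l*_l\theta^l)\Big\},$$ the infimum being over all $(\mu,\theta)\in M\times\Theta$ with $v=\mu^1*_1\theta^1$, $\|\theta^l_{n,k}\|_2\le1$ for all $l,n,k$, and $Z\theta=0$ ($\inf\emptyset=\infty$).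 *Regularizer.* Let $\mathcal R:L^q(\Omega)\to[0,\infty]$ be proper and sequentially weakly lower semicontinuous. Let $U\subset L^q(\Omega)$ be a closed subspace and $P_U$ a continuous linear projection of $L^q(\Omega)$ onto $U$ such that, for some $C>0$, $\mathcal R(u)=\mathcal R(u+w)$ and $\|u-P_Uu\|_q\le C\,\mathcal R(u)$ for all $u\in L^q(\Omega)$, $w\in U$. Suppose that $U$ is finite dimensional, or that $U\cap\ker A$ has a complement $V$ in $U$ with $\|u\|_q\le c\|Au\|_Y$ for all $u\in V$ and some $c>0$. *Data terms.* Let functionals $\mathcal D_{y'}:Y\to[0,\infty]$ ($y'\in Y$), $y\in Y$ and a sequence $(y_m)$ in $Y$ be given such that $\mathcal D_y$ is proper, convex, lower semicontinuous and coercive ($\mathcal D_y(z)\to\infty$ as $\|z\|\to\infty$). Assume $\mathcal D_{y_m}\to\mathcal D_y$, i.e. $\mathcal D_y(z)\le\liminf_m\mathcal D_{y_m}(z_m)$ whenever $z_m\rightharpoonup z$ in $Y$, and $\mathcal D_y(z)\ge\limsup_m\mathcal D_{y_m}(z)$ for all $z\in Y$. Assume also that $(\mathcal D_{y_m})_m$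 is equi-coercive, i.e. there is a coercive $\mathcal D_0:Y\to[0,\infty]$ with $\mathcal D_0\le\mathcal D_{y_m}$ for all $m$. *Claim.* For $y'\in Y$ and $u,v\in L^q(\Omega)$ let $\mathcal E_{y'}(u,v)=\lambda\mathcal D_{y'}(Au)+s_{\mathcal R}\mathcal R(u-v)+s_{\mathcal G}\mathcal G(v)$, and for each $m$ let $(u_m,v_m)$ be a minimizer of $\mathcal E_{y_m}$ on $L^q(\Omega)^2$. Then one of the following holds. 1. $\mathcal E_{y_m}(u_m,v_m)\to\infty$, and $\mathcal E_y(u,v)=\infty$ for all $u,v\in L^q(\Omega)$. 2. $\mathcal E_y$ attains its minimum, the minimum is finite, and $\mathcal E_{y_m}(u_m,v_m)\to\min\mathcal E_y$. Moreover: - there are $w_m\in U\cap\ker A$ such that a subsequence of $(u_m+w_m,v_m)_m$ converges weakly in $L^q(\Omega)^2$ to a minimizer of $\mathcal E_y$; - for all $w_m\in U\cap\ker A$ (in particular for $w_m=0$) and every subsequence $(u_{m_k}+w_{m_k},v_{m_k})_k$ that converges weakly to some $(u,v)\in L^q(\Omega)^2$, the pair $(u,v)$ minimizes $\mathcal E_y$,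 and $\mathcal D_{y_{m_k}}(Au_{m_k})\to\mathcal D_y(Au)$, $\mathcal R(u_{m_k}-v_{m_k})\to\mathcal R(u-v)$ and $\mathcal G(v_{m_k})\to\mathcal G(v)$; - if $\mathcal E_y$ has a unique minimizer $(u,v)$, then $u_m\rightharpoonup u$ and $v_m\rightharpoonup v$ for the whole sequence. -/

import Mathlib

open Filter Topology MeasureTheory
open scoped ENNReal NNReal Pointwise ZeroAtInfty

noncomputable section

namespace StableGen

/-- The ambient space `ℝ^d` with its Euclidean structure. -/
abbrev Space (d : ℕ) : Type := EuclideanSpace ℝ (Fin d)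

/-- `C₀(W)`: continuous real functions on `W` vanishing at infinity, with the uniform norm. -/
abbrev C0 {d : ℕ} (W : Set (Space d)) : Type := C₀(W, ℝ)

/-- Bounded linear maps `𝓛(E, F)` between normed spaces. (The abbreviation only makes Lean use the
instances coming from the norms.) -/
abbrev BoundedMap (E F : Type) [NormedAddCommGroup E] [NormedSpace ℝ E] [NormedAddCommGroup F]
    [NormedSpace ℝ F] : Type :=
  E →L[ℝ] F

/-- The space of Radon measures `𝓜(W)`, defined as the dual of `C₀(W)`; its norm is the dual
(total variation) norm. -/
abbrev Radon {d : ℕ} (W : Set (Space d)) : Type := BoundedMap (C0 W) ℝ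

/-- `L^q(W)` with respect to the Lebesgue measure. -/
abbrev LpOn {d : ℕ} (q : ℝ≥0∞) (W : Set (Space d)) : Type :=
  Lp ℝ q ((volume : Measure (Space d)).restrict W)

/-- Weak convergence of a sequence in a normed space. -/
def WeakTendsto {X : Type*} [NormedAddCommGroup X] [NormedSpace ℝ X] (x : ℕ → X) (x₀ : X) :
    Prop :=
  ∀ f : StrongDual ℝ X, Tendsto (fun m => f (x m)) atTop (𝓝 (f x₀))

/-! ### Convolution of a Radon measure with a square integrable kernel -/

/-- Extension by zero of a function on `W` to all of `ℝ^d`. -/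
def zeroExt {d : ℕ} {W : Set (Space d)} (φ : C0 W) : Space d → ℝ :=
  Function.extend Subtype.val φ 0

section Facts

variable {d : ℕ} {W S : Set (Space d)}

theorem zeroExt_of_mem (φ : C0 W) {x : Space d} (hx : x ∈ W) : zeroExt φ x = φ ⟨x, hx⟩ :=
  Subtype.val_injective.extend_apply φ 0 ⟨x, hx⟩

theorem zeroExt_of_notMem (φ : C0 W) {x : Space d} (hx : x ∉ W) : zeroExt φ x = 0 :=
  Function.extend_apply' _ _ _ (by rintro ⟨a, rfl⟩; exact hx a.2)

theorem abs_zeroExt_le (φ : C0 W) (x : Space d) : |zeroExt φ x| ≤ ‖φ‖ := by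
  by_cases hx : x ∈ W
  · rw [zeroExt_of_mem φ hx]
    exact φ.toBCF.norm_coe_le_norm ⟨x, hx⟩
  · rw [zeroExt_of_notMem φ hx]; simp

theorem zeroExt_add (φ ψ : C0 W) (x : Space d) :
    zeroExt (φ + ψ) x = zeroExt φ x + zeroExt ψ x := by
  by_cases hx : x ∈ W
  · simp [zeroExt_of_mem _ hx]
  · simp [zeroExt_of_notMem _ hx]

theorem zeroExt_smul (c : ℝ) (φ : C0 W) (x : Space d) :
    zeroExt (c • φ) x = c * zeroExt φ x := by
  by_cases hx : x ∈ W
  · simp [zeroExt_of_mem _ hx]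
  · simp [zeroExt_of_notMem _ hx]

theorem exists_compact_zeroExt (φ : C0 W) {ε : ℝ} (hε : 0 < ε) :
    ∃ K : Set (Space d), IsCompact K ∧ K ⊆ W ∧ ∀ x, x ∉ K → |zeroExt φ x| < ε := by
  have h := (Metric.tendsto_nhds.mp (zero_at_infty φ)) ε hε
  obtain ⟨K, hK, hKs⟩ := Filter.mem_cocompact.mp h
  refine ⟨Subtype.val '' K, hK.image continuous_subtype_val, by rintro _ ⟨a, _, rfl⟩; exact a.2, ?_⟩
  intro x hx
  by_cases hxW : x ∈ W
  · rw [zeroExt_of_mem φ hxW]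
    have : (⟨x, hxW⟩ : W) ∈ Kᶜ := fun hm => hx ⟨_, hm, rfl⟩
    simpa using hKs this
  · rw [zeroExt_of_notMem φ hxW]; simpa using hε

theorem continuous_zeroExt (hW : IsOpen W) (φ : C0 W) : Continuous (zeroExt φ) := by
  rw [continuous_iff_continuousAt]
  intro x
  by_cases hx : x ∈ W
  · have h1 : ContinuousAt (zeroExt φ ∘ (Subtype.val : W → Space d)) ⟨x, hx⟩ := by
      have : zeroExt φ ∘ (Subtype.val : W → Space d) = φ := by
        funext a; exact zeroExt_of_mem φ a.2
      rw [this]; exact (map_continuous φ).continuousAt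
    exact (hW.isOpenEmbedding_subtypeVal.continuousAt_iff).mp h1
  · rw [Metric.continuousAt_iff']
    intro ε hε
    obtain ⟨K, hK, hKW, hlt⟩ := exists_compact_zeroExt φ hε
    filter_upwards [hK.isClosed.isOpen_compl.mem_nhds (fun h => hx (hKW h))] with y hy
    rw [zeroExt_of_notMem φ hx]
    simpa using hlt y hy

theorem integrable_kernel (hSb : Bornology.IsBounded S) (g : LpOn 2 S) :
    Integrable g ((volume : Measure (Space d)).restrict S) := by
  have : IsFiniteMeasure ((volume : Measure (Space d)).restrict S) :=
    ⟨by simpa using hSb.measure_lt_top⟩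
  exact (Lp.memLp g).integrable (by norm_num)

theorem integrable_zeroExt_mul (hW : IsOpen W) (hSb : Bornology.IsBounded S) (g : LpOn 2 S)
    (φ : C0 W) (y : Space d) :
    Integrable (fun x => zeroExt φ (x + y) * g x)
      ((volume : Measure (Space d)).restrict S) := by
  refine (integrable_kernel hSb g).bdd_mul (c := ‖φ‖) ?_ ?_
  · exact ((continuous_zeroExt hW φ).comp (by fun_prop)).aestronglyMeasurable
  · exact ae_of_all _ fun x => abs_zeroExt_le φ _

/-- The inner integral `y ↦ ∫_S φ~(x + y) g(x) dx` of the convolution pairing. -/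
def innerInt (g : LpOn 2 S) (φ : C0 W) (y : Space d) : ℝ :=
  ∫ x in S, zeroExt φ (x + y) * g x

theorem continuous_innerInt (hW : IsOpen W) (hSb : Bornology.IsBounded S) (g : LpOn 2 S)
    (φ : C0 W) : Continuous (innerInt g φ) := by
  refine continuous_of_dominated (bound := fun x => ‖φ‖ * ‖g x‖) ?_ ?_ ?_ ?_
  · intro y
    exact (integrable_zeroExt_mul hW hSb g φ y).aestronglyMeasurable
  · intro y
    refine ae_of_all _ fun x => ?_
    rw [norm_mul]
    exact mul_le_mul_of_nonneg_right (abs_zeroExt_le φ _) (norm_nonneg _)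
  · exact (integrable_kernel hSb g).norm.const_mul _
  · refine ae_of_all _ fun x => ?_
    exact ((continuous_zeroExt hW φ).comp (by fun_prop)).mul continuous_const

theorem abs_innerInt_le (hSb : Bornology.IsBounded S) (g : LpOn 2 S)
    (φ : C0 W) (y : Space d) {c : ℝ} (hc : ∀ x ∈ S, |zeroExt φ (x + y)| ≤ c)
    (hS : IsOpen S) :
    |innerInt g φ y| ≤ c * ∫ x in S, ‖g x‖ := by
  rw [← integral_const_mul c (fun x => ‖g x‖)]
  change ‖∫ x in S, zeroExt φ (x + y) * g x‖ ≤ _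
  refine norm_integral_le_of_norm_le ((integrable_kernel hSb g).norm.const_mul c) ?_
  filter_upwards [ae_restrict_mem hS.measurableSet] with x hx
  rw [norm_mul]
  exact mul_le_mul_of_nonneg_right (hc x hx) (norm_nonneg _)

theorem tendsto_innerInt (hW : IsOpen W) (hS : IsOpen S) (hSb : Bornology.IsBounded S)
    (g : LpOn 2 S) (φ : C0 W) :
    Tendsto (fun y : (W - S : Set (Space d)) => innerInt g φ y) (cocompact _) (𝓝 0) := by
  rw [Metric.tendsto_nhds]
  intro ε hε
  set I : ℝ := ∫ x in S, ‖g x‖ with hI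
  have hI0 : 0 ≤ I := integral_nonneg fun _ => norm_nonneg _
  have hδ : 0 < ε / (I + 1) := by positivity
  obtain ⟨K, hK, hKW, hlt⟩ := exists_compact_zeroExt φ hδ
  have hcl : IsCompact (closure S) := hSb.isCompact_closure
  have hKS : IsCompact (K - closure S) := by
    rw [sub_eq_add_neg]
    exact hK.add hcl.neg
  have hsub : K - closure S ⊆ W - S := by
    rintro _ ⟨k, hk, s, hs, rfl⟩
    have hN : {s' : Space d | k + (s' - s) ∈ W} ∈ 𝓝 s := by
      have hc : Continuous fun s' : Space d => k + (s' - s) := by fun_prop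
      exact hc.continuousAt.preimage_mem_nhds (by simpa using hW.mem_nhds (hKW hk))
    obtain ⟨s', hs', hs'S⟩ := mem_closure_iff_nhds.mp hs _ hN
    refine ⟨k + (s' - s), hs', s', hs'S, ?_⟩
    show k + (s' - s) - s' = k - s
    abel
  have hpre : IsCompact ((Subtype.val : (W - S : Set (Space d)) → Space d) ⁻¹'
      (K - closure S)) := by
    rw [Topology.IsInducing.subtypeVal.isCompact_iff, Subtype.image_preimage_coe,
      Set.inter_eq_right.mpr hsub]
    exact hKS
  filter_upwards [hpre.compl_mem_cocompact] with y hy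
  have hb : |innerInt g φ (y : Space d)| ≤ ε / (I + 1) * I := by
    refine abs_innerInt_le hSb g φ _ (fun x hx => (hlt _ fun hmem => hy ?_).le) hS
    refine ⟨x + y, hmem, x, subset_closure hx, ?_⟩
    show x + (y : Space d) - x = y
    abel
  rw [Real.dist_eq, sub_zero]
  refine hb.trans_lt ?_
  rw [div_mul_eq_mul_div, div_lt_iff₀ (by positivity)]
  nlinarith

end Facts

/-- The operator `C₀(W) → C₀(W - S)`, `φ ↦ (y ↦ ∫_S φ~(x + y) g(x) dx)`. -/
def convAdj {d : ℕ} {W S : Set (Space d)} (hW : IsOpen W) (hS : IsOpen S)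
    (hSb : Bornology.IsBounded S) (g : LpOn 2 S) : BoundedMap (C0 W) (C0 (W - S)) :=
  LinearMap.mkContinuous
    { toFun := fun φ =>
        { toFun := fun y => innerInt g φ y
          continuous_toFun := (continuous_innerInt hW hSb g φ).comp continuous_subtype_val
          zero_at_infty' := tendsto_innerInt hW hS hSb g φ }
      map_add' := fun φ ψ => by
        ext y
        show innerInt g (φ + ψ) y = innerInt g φ y + innerInt g ψ y
        unfold innerInt
        rw [← integral_add (integrable_zeroExt_mul hW hSb g φ y)
          (integrable_zeroExt_mul hW hSb g ψ y)]
        simp only [zeroExt_add, add_mul]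
      map_smul' := fun c φ => by
        ext y
        show innerInt g (c • φ) y = c * innerInt g φ y
        unfold innerInt
        rw [← integral_const_mul]
        simp only [zeroExt_smul, mul_assoc] }
    (∫ x in S, ‖g x‖)
    (fun φ => by
      have hI0 : 0 ≤ ∫ x in S, ‖g x‖ := integral_nonneg fun _ => norm_nonneg _
      rw [← ZeroAtInftyContinuousMap.norm_toBCF_eq_norm]
      refine (BoundedContinuousFunction.norm_le (by positivity)).mpr fun y => ?_
      rw [mul_comm]
      exact abs_innerInt_le hSb g φ y (fun x _ => abs_zeroExt_le φ _) hS)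

/-- The convolution `μ * g ∈ 𝓜(W)` of `μ ∈ 𝓜(W - S)` with `g ∈ L²(S)`:
`⟨μ * g, φ⟩ = ∫_{W - S} ∫_S φ~(x + y) g(x) dx dμ(y)`. -/
def conv {d : ℕ} {W S : Set (Space d)} (hW : IsOpen W) (hS : IsOpen S)
    (hSb : Bornology.IsBounded S) (μ : Radon (W - S)) (g : LpOn 2 S) : Radon W :=
  ContinuousLinearMap.comp μ (convAdj hW hS hSb g)

/-- `w ∈ L^q(W)` is identified with the element `φ ↦ ∫_W w φ` of `𝓜(W)`; this is the predicate
that the Radon measure `ρ` is the one given by `w`. -/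
def Represents {d : ℕ} {q : ℝ≥0∞} {W : Set (Space d)} (w : LpOn q W) (ρ : Radon W) : Prop :=
  ∀ φ : C0 W, ∫ x in W, w x * zeroExt φ x = ρ φ

section Facts

variable {d : ℕ} {W S : Set (Space d)}

theorem Represents.unique {q : ℝ≥0∞} [Fact (1 ≤ q)] (hW : IsOpen W) (hWb : Bornology.IsBounded W)
    {w₁ w₂ : LpOn q W} {ρ : Radon W} (h₁ : Represents w₁ ρ) (h₂ : Represents w₂ ρ) : w₁ = w₂ := by
  have : IsFiniteMeasure ((volume : Measure (Space d)).restrict W) :=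
    ⟨by simpa using hWb.measure_lt_top⟩
  have hi : ∀ w : LpOn q W, Integrable w ((volume : Measure (Space d)).restrict W) :=
    fun w => (Lp.memLp w).integrable Fact.out
  have hae : ∀ᵐ x ∂(volume : Measure (Space d)), x ∈ W → (fun x => w₁ x - w₂ x) x = 0 := by
    refine hW.ae_eq_zero_of_integral_contDiff_smul_eq_zero ?_ ?_
    · exact IntegrableOn.locallyIntegrableOn ((hi w₁).sub (hi w₂))
    · intro f hf hfc hfW
      have hz : Tendsto (fun x : W => f x) (cocompact W) (𝓝 0) := by
        have hK : IsCompact ((Subtype.val : W → Space d) ⁻¹' tsupport f) := by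
          rw [Topology.IsInducing.subtypeVal.isCompact_iff, Subtype.image_preimage_coe,
            Set.inter_eq_right.mpr hfW]
          exact hfc
        refine tendsto_const_nhds.congr' ?_
        filter_upwards [hK.compl_mem_cocompact] with x hx
        exact (image_eq_zero_of_notMem_tsupport hx).symm
      let φ : C0 W :=
        { toFun := fun x => f x
          continuous_toFun := hf.continuous.comp continuous_subtype_val
          zero_at_infty' := hz }
      have hφ : zeroExt φ = f := by
        funext x
        by_cases hx : x ∈ W
        · exact zeroExt_of_mem φ hx
        · rw [zeroExt_of_notMem φ hx]
          exact (image_eq_zero_of_notMem_tsupport fun h => hx (hfW h)).symm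
      have e₁ := h₁ φ
      have e₂ := h₂ φ
      rw [hφ] at e₁ e₂
      have hfi : ∀ w : LpOn q W, IntegrableOn (fun x => w x * f x) W := by
        intro w
        obtain ⟨C, hC⟩ := hfc.exists_bound_of_continuous hf.continuous
        exact (hi w).mul_bdd (c := C) hf.continuous.aestronglyMeasurable (ae_of_all _ hC)
      rw [← setIntegral_eq_integral_of_forall_compl_eq_zero (s := W)]
      · have : ∀ x, f x • (w₁ x - w₂ x) = w₁ x * f x - w₂ x * f x := fun x => by
          simp only [smul_eq_mul]; ring
        simp only [this]
        rw [integral_sub (hfi w₁) (hfi w₂), e₁, e₂, sub_self]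
      · intro x hx
        rw [image_eq_zero_of_notMem_tsupport fun h => hx (hfW h), zero_smul]
  refine Lp.ext ?_
  have := (ae_restrict_iff' (μ := (volume : Measure (Space d))) hW.measurableSet).mpr hae
  filter_upwards [this] with x hx
  exact sub_eq_zero.mp hx

theorem memLp_zeroExt (hW : IsOpen W) (hWb : Bornology.IsBounded W) (φ : C0 W) :
    MemLp (zeroExt φ) 2 ((volume : Measure (Space d)).restrict W) := by
  have : IsFiniteMeasure ((volume : Measure (Space d)).restrict W) :=
    ⟨by simpa using hWb.measure_lt_top⟩
  exact MemLp.of_bound (continuous_zeroExt hW φ).aestronglyMeasurable ‖φ‖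
    (ae_of_all _ fun x => abs_zeroExt_le φ x)

/-- The inclusion of `C₀(W)` into `L²(W)`. -/
def toL2 (hW : IsOpen W) (hWb : Bornology.IsBounded W) : C0 W →ₗ[ℝ] LpOn 2 W where
  toFun φ := (memLp_zeroExt hW hWb φ).toLp _
  map_add' φ ψ := by
    rw [← MemLp.toLp_add]
    exact MemLp.toLp_congr _ _ (ae_of_all _ fun x => zeroExt_add φ ψ x)
  map_smul' c φ := by
    rw [RingHom.id_apply, ← MemLp.toLp_const_smul]
    exact MemLp.toLp_congr _ _ (ae_of_all _ fun x => zeroExt_smul c φ x)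

theorem abs_innerInt_le_L2 (hW : IsOpen W) (hWb : Bornology.IsBounded W)
    (g : LpOn 2 S) (φ : C0 W) (y : Space d) :
    |innerInt g φ y| ≤ ‖g‖ * ‖toL2 hW hWb φ‖ := by
  have hmp : MeasurePreserving (fun x : Space d => x + y) volume volume :=
    measurePreserving_add_right _ y
  have hind : W.indicator (zeroExt φ) = zeroExt φ := by
    funext x
    by_cases hx : x ∈ W
    · simp [hx]
    · simp [hx, zeroExt_of_notMem φ hx]
  have hE : MemLp (zeroExt φ) 2 (volume : Measure (Space d)) := by
    rw [← hind]
    exact (memLp_indicator_iff_restrict hW.measurableSet).mpr (memLp_zeroExt hW hWb φ)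
  have hshift : MemLp (fun x => zeroExt φ (x + y)) 2 (volume : Measure (Space d)) :=
    hE.comp_measurePreserving hmp
  have hS : MemLp (fun x => zeroExt φ (x + y)) 2 ((volume : Measure (Space d)).restrict S) :=
    hshift.restrict S
  have hnorm : ‖hS.toLp _‖ ≤ ‖toL2 hW hWb φ‖ := by
    change ‖hS.toLp _‖ ≤ ‖(memLp_zeroExt hW hWb φ).toLp _‖
    rw [Lp.norm_toLp, Lp.norm_toLp]
    refine ENNReal.toReal_mono (memLp_zeroExt hW hWb φ).2.ne ?_
    calc eLpNorm (fun x => zeroExt φ (x + y)) 2 ((volume : Measure (Space d)).restrict S)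
        ≤ eLpNorm (fun x => zeroExt φ (x + y)) 2 (volume : Measure (Space d)) :=
          eLpNorm_mono_measure _ Measure.restrict_le_self
      _ = eLpNorm (zeroExt φ) 2 (volume : Measure (Space d)) :=
          eLpNorm_comp_measurePreserving hE.1 hmp
      _ = eLpNorm (zeroExt φ) 2 ((volume : Measure (Space d)).restrict W) := by
          rw [← eLpNorm_indicator_eq_eLpNorm_restrict hW.measurableSet, hind]
  have hin : innerInt g φ y = inner ℝ g (hS.toLp _) := by
    rw [L2.inner_def]
    refine integral_congr_ae ?_
    filter_upwards [hS.coeFn_toLp] with x hx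
    rw [hx]
    simp
  rw [hin]
  exact (norm_inner_le_norm (𝕜 := ℝ) _ _).trans (mul_le_mul_of_nonneg_left hnorm (norm_nonneg _))

/-- The convolution of `μ ∈ 𝓜(W - S)` and `g ∈ L²(S)` is a function in `L^q(W)`. -/
theorem exists_represents_conv {q : ℝ≥0∞} (hq : q ≤ 2) (hW : IsOpen W)
    (hWb : Bornology.IsBounded W) (hS : IsOpen S) (hSb : Bornology.IsBounded S)
    (μ : Radon (W - S)) (g : LpOn 2 S) :
    ∃ w : LpOn q W, Represents w (conv hW hS hSb μ g) := by
  set F : Radon W := conv hW hS hSb μ g with hF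
  set e := toL2 hW hWb with he
  have hbound : ∀ φ, |F φ| ≤ ‖μ‖ * ‖g‖ * ‖e φ‖ := by
    intro φ
    have h1 : |F φ| ≤ ‖μ‖ * ‖convAdj hW hS hSb g φ‖ := μ.le_opNorm _
    have h2 : ‖convAdj hW hS hSb g φ‖ ≤ ‖g‖ * ‖e φ‖ := by
      rw [← ZeroAtInftyContinuousMap.norm_toBCF_eq_norm]
      exact (BoundedContinuousFunction.norm_le (by positivity)).mpr fun y =>
        abs_innerInt_le_L2 hW hWb g φ y
    calc |F φ| ≤ ‖μ‖ * ‖convAdj hW hS hSb g φ‖ := h1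
      _ ≤ ‖μ‖ * (‖g‖ * ‖e φ‖) := mul_le_mul_of_nonneg_left h2 (norm_nonneg μ)
      _ = _ := by ring
  have hwd : ∀ φ ψ, e φ = e ψ → F φ = F ψ := by
    intro φ ψ h
    have := hbound (φ - ψ)
    rw [map_sub, map_sub, h, sub_self, norm_zero, mul_zero] at this
    exact sub_eq_zero.mp (abs_nonpos_iff.mp this)
  let f : LinearMap.range e →ₗ[ℝ] ℝ :=
    { toFun := fun p => F p.2.choose
      map_add' := fun p r => by
        rw [← map_add]
        apply hwd
        rw [map_add, p.2.choose_spec, r.2.choose_spec, (p + r).2.choose_spec]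
        rfl
      map_smul' := fun c p => by
        rw [RingHom.id_apply, ← map_smul]
        apply hwd
        rw [map_smul, p.2.choose_spec, (c • p).2.choose_spec]
        rfl }
  have hfb : ∀ p, ‖f p‖ ≤ ‖μ‖ * ‖g‖ * ‖p‖ := by
    intro p
    have := hbound p.2.choose
    rw [p.2.choose_spec] at this
    exact this
  obtain ⟨G, hG, -⟩ := exists_extension_norm_eq (LinearMap.range e) (f.mkContinuous _ hfb)
  set h : LpOn 2 W := (InnerProductSpace.toDual ℝ (LpOn 2 W)).symm G with hh
  have : IsFiniteMeasure ((volume : Measure (Space d)).restrict W) :=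
    ⟨by simpa using hWb.measure_lt_top⟩
  have hm : MemLp h q ((volume : Measure (Space d)).restrict W) := (Lp.memLp h).mono_exponent hq
  refine ⟨hm.toLp _, fun φ => ?_⟩
  have h1 : G (e φ) = F φ := by
    have := hG ⟨e φ, φ, rfl⟩
    refine this.trans ?_
    exact hwd _ _ (Exists.choose_spec (⟨φ, rfl⟩ : ∃ a, e a = e φ))
  rw [← h1, ← InnerProductSpace.toDual_symm_apply (𝕜 := ℝ), L2.inner_def]
  refine integral_congr_ae ?_
  filter_upwards [hm.coeFn_toLp, (memLp_zeroExt hW hWb φ).coeFn_toLp] with x hx hx'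
  have hx'' : (e φ : LpOn 2 W) x = zeroExt φ x := hx'
  rw [hx, hx'']
  simp [hh, mul_comm]

end Facts

/-- The function `μ * g ∈ L^q(W)`: the element of `L^q(W)` representing the convolution. For open
bounded `W` and `q ≤ 2` it exists by `exists_represents_conv`, and it is the only one by
`Represents.unique`. -/
def convLq {d : ℕ} (q : ℝ≥0∞) {W S : Set (Space d)} (hW : IsOpen W) (hS : IsOpen S)
    (hSb : Bornology.IsBounded S) (μ : Radon (W - S)) (g : LpOn 2 S) : LpOn q W :=
  Classical.epsilon fun w => Represents w (conv hW hS hSb μ g)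

/-! ### The network architecture and the generative prior -/

/-- A bounded domain: bounded, open and simply connected. -/
structure IsBoundedDomain {d : ℕ} (W : Set (Space d)) : Prop where
  isOpen : IsOpen W
  isBounded : Bornology.IsBounded W
  isSimplyConnected : IsSimplyConnected W

/-- The image domain `Ω` and the kernel domain `Σ` (written `S`), with `0 ∈ Σ`. -/
structure Geometry (d : ℕ) where
  Ω : Set (Space d)
  S : Set (Space d)
  domain_Ω : IsBoundedDomain Ω
  domain_S : IsBoundedDomain S
  zero_mem : (0 : Space d) ∈ S

/-- `Ω^0 = Ω` and `Ω^{l+1} = Ω^l - Σ`. -/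
def Geometry.layer {d : ℕ} (X : Geometry d) : ℕ → Set (Space d)
  | 0 => X.Ω
  | l + 1 => X.layer l - X.S

theorem Geometry.isOpen_layer {d : ℕ} (X : Geometry d) : ∀ l, IsOpen (X.layer l)
  | 0 => X.domain_Ω.isOpen
  | l + 1 => (X.isOpen_layer l).sub_right

/-- A network with `L = depth + 1 ≥ 1` hidden layers. Layer `l` has `N l` latent variables, with
`N 0 = 1`. For `j = 0, …, L - 1`, the set `conn j` (`E^{j+1}` in the usual notation) consists of
the connections `(n, k)` between the latent variable `n` of layer `j + 1` and the latent variable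
`k` of layer `j`. -/
structure Architecture where
  depth : ℕ
  N : ℕ → ℕ
  N_zero : N 0 = 1
  conn : (j : Fin (depth + 1)) → Finset (Fin (N ((j : ℕ) + 1)) × Fin (N (j : ℕ)))
  connected : ∀ j n, ∃ k, (n, k) ∈ conn j

section Prior

variable {d : ℕ} (X : Geometry d) (a : Architecture)

/-- `M^l = 𝓜(Ω^l)^{N_l}`. -/
abbrev LatentLayer (l : ℕ) : Type := Fin (a.N l) → Radon (X.layer l)

/-- `M = M^1 × ⋯ × M^L`; the component with index `j` is the one in `M^{j+1}`. -/
abbrev Latent : Type := (j : Fin (a.depth + 1)) → LatentLayer X a ((j : ℕ) + 1)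

/-- `Θ^{j+1} = L²(Σ)^{E^{j+1}}`. -/
abbrev KernelLayer (j : Fin (a.depth + 1)) : Type := a.conn j → LpOn 2 X.S

/-- `Θ = Θ^1 × ⋯ × Θ^L`; the component with index `j` is the one in `Θ^{j+1}`. -/
abbrev Kernels : Type := (j : Fin (a.depth + 1)) → KernelLayer X a j

variable {X a}

/-- Component-wise weak* convergence in `M^l`. -/
def WeakStarTendsto {l : ℕ} (μ : ℕ → LatentLayer X a l) (μ₀ : LatentLayer X a l) : Prop :=
  ∀ (n : Fin (a.N l)) (φ : C0 (X.layer l)), Tendsto (fun m => μ m n φ) atTop (𝓝 (μ₀ n φ))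

/-- The vectorial convolution `M^{j+1} × Θ^{j+1} → M^j`, with `k`-th component
`∑_{(n,k) ∈ E^{j+1}} μ_n * θ_{n,k}`. -/
def layerConv (j : Fin (a.depth + 1)) (μ : LatentLayer X a ((j : ℕ) + 1))
    (θ : KernelLayer X a j) : LatentLayer X a (j : ℕ) := fun k =>
  ∑ e : a.conn j, if e.1.2 = k then
    conv (X.isOpen_layer j) X.domain_S.isOpen X.domain_S.isBounded (μ e.1.1) (θ e) else 0

/-- The index of the first layer. -/
abbrev Architecture.first (a : Architecture) : Fin (a.depth + 1) := ⟨0, Nat.succ_pos _⟩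

/-- The output convolution `M^1 × Θ^1 → L^q(Ω)`, `(μ, θ) ↦ ∑_n μ_n * θ_{n,1}`. As `N 0 = 1`, every
latent variable `n` of the first layer occurs in exactly one connection. -/
def outputConv (q : ℝ≥0∞) [Fact (1 ≤ q)] (μ : LatentLayer X a 1) (θ : KernelLayer X a a.first) :
    LpOn q X.Ω :=
  ∑ e : a.conn a.first,
    convLq q X.domain_Ω.isOpen X.domain_S.isOpen X.domain_S.isBounded (μ e.1.1) (θ e)

/-- The mismatch `μ^{l-1} - μ^l *_l θ^l ∈ M^{l-1}` for `l = j + 2`, where `j = 0, …, L - 2`. -/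
def layerMismatch (j : Fin a.depth) (μ : Latent X a) (θ : Kernels X a) :
    LatentLayer X a ((j : ℕ) + 1) :=
  let lower : LatentLayer X a ((j : ℕ) + 1) := μ j.castSucc
  let upper : LatentLayer X a ((j : ℕ) + 1) := layerConv j.succ (μ j.succ) (θ j.succ)
  lower - upper

/-- `G(μ, θ) = ‖μ‖_𝓜 + ∑_{l=2}^{L} J_{l-1}(μ^{l-1} - μ^l *_l θ^l)`. The functional `J j`, for
`j = 0, …, L - 2`, is the one on `M^{j+1}`. -/
def networkEnergy (J : (j : Fin a.depth) → LatentLayer X a ((j : ℕ) + 1) → ℝ≥0∞)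
    (μ : Latent X a) (θ : Kernels X a) : ℝ≥0∞ :=
  (∑ j, ∑ n, ‖μ j n‖ₑ) +
    ∑ j : Fin a.depth, J j (layerMismatch j μ θ)

/-- The constraints: `v = μ^1 *_1 θ^1`, `‖θ^l_{n,k}‖_2 ≤ 1` for all `n, k, l`, and `Z θ = 0`. -/
structure Feasible {q : ℝ≥0∞} [Fact (1 ≤ q)] {Nc : ℕ} (Z : Kernels X a →L[ℝ] (Fin Nc → ℝ))
    (v : LpOn q X.Ω) (μ : Latent X a) (θ : Kernels X a) : Prop where
  output : v = outputConv q (μ a.first) (θ a.first)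
  norm_le : ∀ j e, ‖θ j e‖ ≤ 1
  linear : Z θ = 0

/-- The generative prior; it is `∞` where the constraints cannot be met. -/
def genPrior {q : ℝ≥0∞} [Fact (1 ≤ q)] {Nc : ℕ} (Z : Kernels X a →L[ℝ] (Fin Nc → ℝ))
    (J : (j : Fin a.depth) → LatentLayer X a ((j : ℕ) + 1) → ℝ≥0∞) (v : LpOn q X.Ω) : ℝ≥0∞ :=
  ⨅ (μ : Latent X a) (θ : Kernels X a) (_ : Feasible Z v μ θ), networkEnergy J μ θ

end Prior

/-! ### The variational problem -/

/-- Coercivity: `F x → ∞` as `‖x‖ → ∞`. -/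
def Coercive {E : Type*} [NormedAddCommGroup E] (F : E → ℝ≥0∞) : Prop :=
  Tendsto F (Bornology.cobounded E) (𝓝 ⊤)

/-- Convexity of a `[0, ∞]`-valued function. -/
def ConvexFun {E : Type*} [AddCommGroup E] [Module ℝ E] (F : E → ℝ≥0∞) : Prop :=
  ∀ (x z : E) (s t : ℝ), 0 ≤ s → 0 ≤ t → s + t = 1 →
    F (s • x + t • z) ≤ ENNReal.ofReal s * F x + ENNReal.ofReal t * F z

/-- Convergence `D_m → D` of data fidelity functionals. -/
structure DataTendsto {Y : Type*} [NormedAddCommGroup Y] [NormedSpace ℝ Y] (Dm : ℕ → Y → ℝ≥0∞)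
    (D : Y → ℝ≥0∞) : Prop where
  le_liminf : ∀ (z : ℕ → Y) (z₀ : Y), WeakTendsto z z₀ →
    D z₀ ≤ liminf (fun m => Dm m (z m)) atTop
  limsup_le : ∀ z : Y, limsup (fun m => Dm m z) atTop ≤ D z

/-- Equi-coercivity of a sequence of functionals. -/
def EquiCoercive {Y : Type*} [NormedAddCommGroup Y] (Dm : ℕ → Y → ℝ≥0∞) : Prop :=
  ∃ D₀ : Y → ℝ≥0∞, Coercive D₀ ∧ ∀ m z, D₀ z ≤ Dm m z

/-- The conditions on the data term `D`. -/
structure DataTermAssumption {Y : Type*} [NormedAddCommGroup Y] [NormedSpace ℝ Y]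
    (D : Y → ℝ≥0∞) : Prop where
  proper : ∃ z, D z ≠ ⊤
  coercive : Coercive D
  lsc : LowerSemicontinuous D
  convex : ConvexFun D

/-- The conditions on the functionals `J_l`: weak* (sequential) lower semicontinuity and
`J_l(0) = 0`. -/
structure PenaltyAssumption {d : ℕ} {X : Geometry d} {a : Architecture}
    (J : (j : Fin a.depth) → LatentLayer X a ((j : ℕ) + 1) → ℝ≥0∞) : Prop where
  lsc : ∀ (j : Fin a.depth) (μ : ℕ → LatentLayer X a ((j : ℕ) + 1))
    (μ₀ : LatentLayer X a ((j : ℕ) + 1)), WeakStarTendsto μ μ₀ →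
      J j μ₀ ≤ liminf (fun m => J j (μ m)) atTop
  zero : ∀ j, J j 0 = 0

/-- The conditions on the regularizer `R`, the closed subspace `U` of its invariances and the
forward operator `A`. -/
structure RegularizerAssumption {E Y : Type*} [NormedAddCommGroup E] [NormedSpace ℝ E]
    [NormedAddCommGroup Y] [NormedSpace ℝ Y] (A : E →L[ℝ] Y) (R : E → ℝ≥0∞)
    (U : Submodule ℝ E) : Prop where
  proper : ∃ u, R u ≠ ⊤
  weak_lsc : ∀ (u : ℕ → E) (u₀ : E), WeakTendsto u u₀ →
    R u₀ ≤ liminf (fun m => R (u m)) atTop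
  closed : IsClosed (U : Set E)
  invariant : ∀ u, ∀ w ∈ U, R u = R (u + w)
  projection : ∃ P : E →L[ℝ] E, (∀ u, P u ∈ U) ∧ (∀ w ∈ U, P w = w) ∧
    ∃ C : ℝ≥0, 0 < C ∧ ∀ u, ‖u - P u‖ₑ ≤ C * R u
  kernel : FiniteDimensional ℝ U ∨
    ∃ V : Submodule ℝ E, V ≤ U ∧
      V ⊓ (U ⊓ LinearMap.ker A.toLinearMap) = ⊥ ∧
      V ⊔ (U ⊓ LinearMap.ker A.toLinearMap) = U ∧
      ∃ c : ℝ, 0 < c ∧ ∀ u ∈ V, ‖u‖ ≤ c * ‖A u‖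

/-- The weight `s_R(ν)`. -/
def weightR (ν : ℝ) : ℝ := ν / min ν (1 - ν)

/-- The weight `s_G(ν)`. -/
def weightG (ν : ℝ) : ℝ := (1 - ν) / min ν (1 - ν)

/-- The energy `(u, v) ↦ λ D(Au) + s_R(ν) R(u - v) + s_G(ν) G(v)`. -/
def energy {E Y : Type*} [NormedAddCommGroup E] [NormedSpace ℝ E] [NormedAddCommGroup Y]
    [NormedSpace ℝ Y] (lam ν : ℝ) (A : E →L[ℝ] Y) (D : Y → ℝ≥0∞) (R G : E → ℝ≥0∞)
    (u v : E) : ℝ≥0∞ :=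
  ENNReal.ofReal lam * D (A u) + ENNReal.ofReal (weightR ν) * R (u - v)
    + ENNReal.ofReal (weightG ν) * G v

/-- `(u, v)` is a global minimizer of `F`. -/
def IsMinimizer {E : Type*} (F : E → E → ℝ≥0∞) (u v : E) : Prop :=
  ∀ u' v', F u v ≤ F u' v'

end StableGen

end

/-! The proof is the fundamental theorem of Γ-convergence, taken modulo the directions `U ∩ ker A`,
along which the energy is constant (`energy_shift`).

Lower bound: along weakly convergent sequences each of the three terms is lower semicontinuous, so
the energies satisfy a liminf inequality (`energy_le_liminf`). Upper bound: the data terms converge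
pointwise, so constant sequences are recovery sequences (`tendsto_energy`). Compactness: on a
sublevel set, `D₀` bounds `A u`, the prior bounds `v`, and `R (u - v)` bounds `u` modulo `U`; the
part of `u` in `U` is removed by a shift or controlled by `A u` (`exists_shift_bound`). Bounded
sequences in `L^q` have weakly convergent subsequences since `1 < q < ∞`. Hence cluster points of
shifted minimizers minimize the limit energy, and the optimal values converge. When a sum of lower
semicontinuous terms converges to its finite lower bound, no single term can jump
(`tendsto_terms_of_tendsto_energy`).

The remaining work concerns the prior. It must be weakly lower semicontinuous (`genPrior_le_liminf`)
and must bound the norm (`exists_enorm_le_genPrior`). For the first, a bound on the network energy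
and the constraint on the kernels make measures and kernels sequentially compact, weakly* and
weakly. The convolution is jointly continuous for these topologies, although bilinear, because its
adjoint `g ↦ convAdj g φ` turns bounded weak convergence into norm convergence (`tendsto_convAdj`).
For the second, `‖μ * g‖_q ≤ c ‖μ‖ ‖g‖₂`. -/

noncomputable section

namespace StableGen

/-! ### Duality and weak sequential compactness of L^p for 1 < p < ∞. -/

section Duality

variable {α : Type*} [MeasurableSpace α] {μ : Measure α}
  {p q : ℝ≥0∞} [Fact (1 ≤ p)] [Fact (1 ≤ q)]

/-- The functional on `L^p` given by integration against an element of `L^q`. -/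
def dualPairing [ENNReal.HolderConjugate q p] (g : Lp ℝ q μ) : StrongDual ℝ (Lp ℝ p μ) :=
  (ContinuousLinearMap.mul ℝ ℝ).lpPairing μ q p g

theorem dualPairing_apply [ENNReal.HolderConjugate q p] (g : Lp ℝ q μ) (f : Lp ℝ p μ) :
    dualPairing g f = ∫ x, g x * f x ∂μ := by
  simp [dualPairing, ContinuousLinearMap.lpPairing_eq_integral]

/-- The converse of Hölder's inequality. -/
theorem norm_le_norm_dualPairing (hp : p ≠ ∞) (hq : q ≠ ∞) [hpq : ENNReal.HolderConjugate q p]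
    (g : Lp ℝ q μ) : ‖g‖ ≤ ‖(dualPairing g : StrongDual ℝ (Lp ℝ p μ))‖ := by
  have hr : q.toReal.HolderConjugate p.toReal :=
    ENNReal.HolderConjugate.toReal_of_ne_top hq hp
  have hq1 : 0 < q.toReal - 1 := hr.sub_one_pos
  have hexp : p * ENNReal.ofReal (q.toReal - 1) = q := by
    rw [← ENNReal.ofReal_toReal hp, ← ENNReal.ofReal_mul hr.symm.nonneg,
      mul_comm, hr.sub_one_mul_conj, ENNReal.ofReal_toReal hq]
  -- The extremal function of Hölder's inequality: `|f₀|^p = |g|^q` since `p (q - 1) = q`, and `g f₀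
  -- = |g|^q`. The exponent `q - 2` may be negative; where `g = 0`, the factor `g x` makes `f₀`
  -- vanish whatever value the power takes.
  set f₀ : α → ℝ := fun x => g x * ‖g x‖ ^ (q.toReal - 2) with hf₀
  have hgm : AEMeasurable g μ := (Lp.aestronglyMeasurable g).aemeasurable
  have hfm : AEStronglyMeasurable f₀ μ := by
    refine AEMeasurable.aestronglyMeasurable ?_
    fun_prop
  have hnorm : eLpNorm f₀ p μ = eLpNorm g q μ ^ (q.toReal - 1) := by
    have := eLpNorm_norm_rpow (p := p) (μ := μ) g hq1
    rw [hexp] at this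
    rw [← this]
    refine eLpNorm_congr_norm_ae (ae_of_all _ fun x => ?_)
    rcases (norm_nonneg (g x)).eq_or_lt with h | h
    · rw [hf₀, norm_mul, ← h, zero_mul, Real.zero_rpow hq1.ne', norm_zero]
    · rw [hf₀, norm_mul, Real.norm_of_nonneg (Real.rpow_nonneg (norm_nonneg _) _),
        Real.norm_of_nonneg (Real.rpow_nonneg (norm_nonneg _) _)]
      nth_rewrite 1 [← Real.rpow_one ‖g x‖]
      rw [← Real.rpow_add h]; congr 1; ring
  have hmem : MemLp f₀ p μ := ⟨hfm, by
    rw [hnorm]; exact ENNReal.rpow_lt_top_of_nonneg hq1.le (Lp.eLpNorm_ne_top g)⟩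
  have hpair : dualPairing g (hmem.toLp f₀) = ‖g‖ ^ q.toReal := by
    rw [dualPairing_apply, Lp.norm_def, (Lp.memLp g).eLpNorm_eq_integral_rpow_norm
      (one_pos.trans_le Fact.out).ne' hq, ENNReal.toReal_ofReal (by positivity),
      ← Real.rpow_mul (integral_nonneg fun x => by positivity), inv_mul_cancel₀ hr.ne_zero,
      Real.rpow_one]
    refine integral_congr_ae ?_
    filter_upwards [hmem.coeFn_toLp] with x hx
    rw [hx, hf₀]
    simp only
    rw [← mul_assoc, ← abs_mul_abs_self (g x), ← Real.norm_eq_abs]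
    rcases (norm_nonneg (g x)).eq_or_lt with h | h
    · rw [← h, zero_mul, zero_mul, Real.zero_rpow hr.ne_zero]
    · rw [← sq, ← Real.rpow_natCast, ← Real.rpow_add h]; congr 1; push_cast; ring
  have hfn : ‖hmem.toLp f₀‖ = ‖g‖ ^ (q.toReal - 1) := by
    rw [Lp.norm_toLp, hnorm, ← ENNReal.toReal_rpow, ← Lp.norm_def]
  have hle := (le_abs_self _).trans
    ((dualPairing g : StrongDual ℝ (Lp ℝ p μ)).le_opNorm (hmem.toLp f₀))
  rw [hpair, hfn] at hle
  rcases (norm_nonneg g).eq_or_lt with h | h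
  · rw [← h]; exact norm_nonneg _
  · have h2 : ‖g‖ ^ q.toReal = ‖g‖ * ‖g‖ ^ (q.toReal - 1) := by
      nth_rewrite 2 [← Real.rpow_one ‖g‖]
      rw [← Real.rpow_add h]; congr 1; ring
    rw [h2] at hle
    exact le_of_mul_le_mul_right hle (by positivity)

variable [IsFiniteMeasure μ]

/-- Continuous functionals on `L^p` that agree on indicator functions are equal. -/
theorem dual_Lp_ext (hp : p ≠ ∞) {Λ Λ' : StrongDual ℝ (Lp ℝ p μ)}
    (h : ∀ (s : Set α) (hs : MeasurableSet s),
      Λ (indicatorConstLp p hs (measure_ne_top μ s) 1)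
        = Λ' (indicatorConstLp p hs (measure_ne_top μ s) 1)) : Λ = Λ' := by
  ext f
  induction f using Lp.induction hp with
  | @indicatorConst c s hs hμs =>
    rw [Lp.simpleFunc.coe_indicatorConst]
    have : indicatorConstLp (μ := μ) p hs hμs.ne c
        = c • indicatorConstLp p hs hμs.ne (1 : ℝ) := by
      refine Lp.ext ?_
      filter_upwards [Lp.coeFn_smul c (indicatorConstLp p hs hμs.ne (1 : ℝ)),
        indicatorConstLp_coeFn (p := p) (hs := hs) (hμs := hμs.ne) (c := c),
        indicatorConstLp_coeFn (p := p) (hs := hs) (hμs := hμs.ne) (c := (1 : ℝ))] with x h1 h2 h3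
      rw [h1, h2, Pi.smul_apply, h3]
      by_cases hx : x ∈ s <;> simp [hx]
    rw [this, map_smul, map_smul, h _ hs]
  | add hf hg _ h1 h2 => rw [map_add, map_add, h1, h2]
  | isClosed => exact isClosed_eq Λ.continuous Λ'.continuous

open Classical in
/-- The signed measure `s ↦ Λ 1_s` of a functional `Λ` on `L^p`. -/
def dualMeasure (hp : p ≠ ∞) (Λ : StrongDual ℝ (Lp ℝ p μ)) : SignedMeasure α where
  measureOf' s := if hs : MeasurableSet s then
    Λ (indicatorConstLp p hs (measure_ne_top μ s) 1) else 0
  empty' := by simp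
  not_measurable' s hs := by simp [hs]
  m_iUnion' f hf hd := by
    have hfin : ∀ F : Finset ℕ, MeasurableSet (⋃ i ∈ F, f i) := fun F =>
      F.measurableSet_biUnion fun i _ => hf i
    have hsum : ∀ F : Finset ℕ, ∑ i ∈ F, Λ (indicatorConstLp p (hf i) (measure_ne_top μ _) 1)
        = Λ (indicatorConstLp p (hfin F) (measure_ne_top μ _) 1) := by
      intro F
      induction F using Finset.induction_on with
      | empty => simp
      | insert i F hi ih =>
        rw [Finset.sum_insert hi, ih, ← map_add]
        have hdis : Disjoint (f i) (⋃ j ∈ F, f j) := by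
          simp only [Set.disjoint_iUnion_right]
          intro j hj
          exact hd fun h => hi (h ▸ hj)
        rw [← indicatorConstLp_disjoint_union (hf i) (hfin F) _ _ hdis]
        congr 2
        simp
    simp only [hf, MeasurableSet.iUnion hf, dif_pos]
    unfold HasSum
    simp only [hsum]
    refine (Λ.continuous.tendsto _).comp (tendsto_indicatorConstLp_set hp ?_)
    -- A finite union differs from the full union by a set covered by the remaining `f i`, whose
    -- measures sum to a tail of a convergent series; so the indicators converge in L^p.
    have hne : ∑' i, μ (f i) ≠ ∞ := by
      rw [← measure_iUnion hd hf]; exact measure_ne_top _ _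
    refine tendsto_of_tendsto_of_tendsto_of_le_of_le tendsto_const_nhds
      (ENNReal.tendsto_tsum_compl_atTop_zero hne) (fun _ => zero_le) fun F => ?_
    refine (measure_mono ?_).trans (measure_iUnion_le (μ := μ) fun b : {x // x ∉ F} => f b)
    intro x hx
    rcases hx with ⟨h1, h2⟩ | ⟨h1, h2⟩
    · exact absurd (Set.iUnion₂_subset_iUnion _ _ h1) h2
    · obtain ⟨i, hi⟩ := Set.mem_iUnion.mp h1
      refine Set.mem_iUnion.mpr ⟨⟨i, fun hF => h2 ?_⟩, hi⟩
      exact Set.mem_biUnion hF hi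

theorem dualMeasure_apply (hp : p ≠ ∞) (Λ : StrongDual ℝ (Lp ℝ p μ)) {s : Set α}
    (hs : MeasurableSet s) :
    dualMeasure hp Λ s = Λ (indicatorConstLp p hs (measure_ne_top μ s) 1) :=
  dif_pos hs

/-- Every functional on `L^p` has an integrable density on indicator functions. -/
theorem exists_density (hp : p ≠ ∞) (Λ : StrongDual ℝ (Lp ℝ p μ)) :
    ∃ h : α → ℝ, Measurable h ∧ Integrable h μ ∧ ∀ (s : Set α) (hs : MeasurableSet s),
      Λ (indicatorConstLp p hs (measure_ne_top μ s) 1) = ∫ x in s, h x ∂μ := by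
  have hac : dualMeasure hp Λ ≪ᵥ μ.toENNRealVectorMeasure := by
    refine VectorMeasure.AbsolutelyContinuous.mk fun s hs h0 => ?_
    rw [Measure.toENNRealVectorMeasure_apply_measurable hs] at h0
    rw [dualMeasure_apply hp Λ hs]
    have : indicatorConstLp (μ := μ) p hs (measure_ne_top μ s) (1 : ℝ) = 0 := by
      rw [← norm_eq_zero, norm_indicatorConstLp (one_pos.trans_le Fact.out).ne' hp]
      have hp0 : p.toReal ≠ 0 :=
        (ENNReal.toReal_pos (one_pos.trans_le Fact.out).ne' hp).ne'
      simp [Measure.real, h0, hp0]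
    rw [this, map_zero]
  refine ⟨(dualMeasure hp Λ).rnDeriv μ, SignedMeasure.measurable_rnDeriv _ _,
    SignedMeasure.integrable_rnDeriv _ _, fun s hs => ?_⟩
  rw [← dualMeasure_apply hp Λ hs, ← withDensityᵥ_apply (SignedMeasure.integrable_rnDeriv _ _) hs,
    SignedMeasure.withDensityᵥ_rnDeriv_eq _ _ hac]

theorem dualPairing_indicator [ENNReal.HolderConjugate q p] (g : Lp ℝ q μ) {s : Set α}
    (hs : MeasurableSet s) :
    dualPairing g (indicatorConstLp p hs (measure_ne_top μ s) 1) = ∫ x in s, g x ∂μ := by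
  rw [dualPairing_apply, ← integral_indicator hs]
  refine integral_congr_ae ?_
  filter_upwards [indicatorConstLp_coeFn (p := p) (hs := hs) (hμs := measure_ne_top μ s)
    (c := (1 : ℝ))] with x hx
  rw [hx]
  by_cases h : x ∈ s <;> simp [h]

/-- Every bounded functional on `L^p`, `1 < p < ∞`, is given by an element of `L^q`. -/
theorem exists_eq_dualPairing (hp : p ≠ ∞) (hq : q ≠ ∞) [hpq : ENNReal.HolderConjugate q p]
    (Λ : StrongDual ℝ (Lp ℝ p μ)) : ∃ g : Lp ℝ q μ, Λ = dualPairing g := by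
  obtain ⟨h, hm, hi, hΛ⟩ := exists_density hp Λ
  -- Truncation shows that the density is in L^q. On `A n` it is bounded, and there it represents `Λ
  -- ∘ T n`, where `T n` multiplies by the indicator of `A n` and has norm at most 1. The converse
  -- Hölder inequality bounds every truncation by `‖Λ‖`, and Fatou's lemma passes the bound to `h`.
  let A : ℕ → Set α := fun n => {x | ‖h x‖ ≤ n}
  have hA : ∀ n, MeasurableSet (A n) := fun n => measurableSet_le hm.norm measurable_const
  let T : ℕ → Lp ℝ p μ →L[ℝ] Lp ℝ p μ := fun n =>
    (ContinuousLinearMap.mul ℝ ℝ).holderL μ ∞ p p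
      (indicatorConstLp ∞ (hA n) (measure_ne_top μ _) 1)
  have hT : ∀ n, ‖T n‖ ≤ 1 := by
    intro n
    refine ContinuousLinearMap.opNorm_le_bound _ zero_le_one fun f => ?_
    refine (ContinuousLinearMap.norm_holder_apply_apply_le _ _ _).trans ?_
    gcongr
    rw [ContinuousLinearMap.opNorm_mul, one_mul]
    exact (norm_indicatorConstLp_le).trans (by simp)
  have hTs : ∀ n (s : Set α) (hs : MeasurableSet s),
      T n (indicatorConstLp p hs (measure_ne_top μ s) 1)
        = indicatorConstLp p ((hA n).inter hs) (measure_ne_top μ _) 1 := by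
    intro n s hs
    refine Lp.ext ?_
    refine ((ContinuousLinearMap.mul ℝ ℝ).coeFn_holder (r := p)
      (indicatorConstLp ∞ (hA n) (measure_ne_top μ _) 1)
      (indicatorConstLp p hs (measure_ne_top μ s) 1)).trans ?_
    filter_upwards [indicatorConstLp_coeFn (p := p) (hs := hs) (hμs := measure_ne_top μ s)
      (c := (1 : ℝ)), indicatorConstLp_coeFn (p := p) (hs := (hA n).inter hs)
      (hμs := measure_ne_top μ _) (c := (1 : ℝ)), indicatorConstLp_coeFn (p := ∞) (hs := hA n)
      (hμs := measure_ne_top μ _) (c := (1 : ℝ))] with x h1 h2 h3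
    rw [h1, h2, h3]
    by_cases h4 : x ∈ s <;> by_cases h5 : x ∈ A n <;> simp [h4, h5]
  have hgm : ∀ n, MemLp ((A n).indicator h) q μ := fun n => by
    refine MemLp.of_bound (hm.indicator (hA n)).aestronglyMeasurable n (ae_of_all _ fun x => ?_)
    by_cases hx : x ∈ A n
    · rw [Set.indicator_of_mem hx]; exact hx
    · simp [hx]
  have hg : ∀ n, (dualPairing ((hgm n).toLp _) : StrongDual ℝ (Lp ℝ p μ)) = Λ.comp (T n) := by
    intro n
    refine dual_Lp_ext hp fun s hs => ?_
    rw [dualPairing_indicator, ContinuousLinearMap.comp_apply, hTs, hΛ,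
      integral_congr_ae (ae_restrict_of_ae (hgm n).coeFn_toLp), Set.inter_comm,
      setIntegral_indicator (hA n)]
  have hbound : ∀ n, eLpNorm ((A n).indicator h) q μ ≤ ENNReal.ofReal ‖Λ‖ := by
    intro n
    have h1 := norm_le_norm_dualPairing (p := p) hp hq ((hgm n).toLp _)
    rw [hg n, Lp.norm_toLp] at h1
    have h2 : ‖Λ.comp (T n)‖ ≤ ‖Λ‖ :=
      (ContinuousLinearMap.opNorm_comp_le _ _).trans
        (mul_le_of_le_one_right (norm_nonneg _) (hT n))
    rw [← ENNReal.ofReal_toReal (hgm n).2.ne]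
    exact ENNReal.ofReal_le_ofReal (h1.trans h2)
  have hlim : ∀ x, Tendsto (fun n => (A n).indicator h x) atTop (𝓝 (h x)) := by
    intro x
    obtain ⟨N, hN⟩ := exists_nat_ge ‖h x‖
    refine tendsto_const_nhds.congr' ?_
    filter_upwards [eventually_ge_atTop N] with n hn
    have : x ∈ A n := hN.trans (by exact_mod_cast hn)
    simp [this]
  have hmem : MemLp h q μ := by
    refine ⟨hm.aestronglyMeasurable, ?_⟩
    refine (Lp.eLpNorm_lim_le_liminf_eLpNorm (fun n => (hgm n).1) h (ae_of_all _ hlim)).trans_lt ?_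
    refine lt_of_le_of_lt ?_ (ENNReal.ofReal_lt_top (r := ‖Λ‖))
    exact liminf_le_of_le (by isBoundedDefault) fun b hb => by
      obtain ⟨n, hn⟩ := hb.exists
      exact hn.trans (hbound n)
  refine ⟨hmem.toLp h, dual_Lp_ext hp fun s hs => ?_⟩
  rw [dualPairing_indicator, hΛ, integral_congr_ae (ae_restrict_of_ae hmem.coeFn_toLp)]

/-- Sequential Banach-Alaoglu theorem, in terms of sequences. -/
theorem exists_subseq_weakStar {E : Type*} [NormedAddCommGroup E] [NormedSpace ℝ E]
    [TopologicalSpace.SeparableSpace E] (f : ℕ → StrongDual ℝ E) (C : ℝ) (hf : ∀ n, ‖f n‖ ≤ C) :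
    ∃ g : StrongDual ℝ E, ∃ k : ℕ → ℕ, StrictMono k ∧
      ∀ x, Tendsto (fun n => f (k n) x) atTop (𝓝 (g x)) := by
  obtain ⟨g, -, k, hk, h⟩ := WeakDual.isSeqCompact_closedBall ℝ E 0 C
    (x := fun n => StrongDual.toWeakDual (f n)) (fun n => by simpa using hf n)
  refine ⟨WeakDual.toStrongDual g, k, hk, fun x => ?_⟩
  exact ((WeakDual.eval_continuous x).tendsto g).comp h

/-- Bounded sequences in `L^p`, `1 < p < ∞`, have weakly convergent subsequences. -/
theorem exists_subseq_weakTendsto_Lp [MeasurableSpace.CountablyGenerated α] (hp1 : 1 < p)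
    (hp : p ≠ ∞) (f : ℕ → Lp ℝ p μ) (C : ℝ)
    (hf : ∀ n, ‖f n‖ ≤ C) :
    ∃ g : Lp ℝ p μ, ∃ k : ℕ → ℕ, StrictMono k ∧ WeakTendsto (fun n => f (k n)) g := by
  let q := ENNReal.conjExponent p
  have hpq : ENNReal.HolderConjugate p q := .conjExponent hp1.le
  have hqp : ENNReal.HolderConjugate q p := hpq.symm
  have hq : q ≠ ∞ := by
    simp only [q, ENNReal.conjExponent]
    simp [tsub_eq_zero_iff_le, hp1]
  have : Fact (1 ≤ q) := ⟨hqp.one_le⟩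
  have : Fact (p ≠ ∞) := ⟨hp⟩
  have : Fact (q ≠ ∞) := ⟨hq⟩
  -- Reflexivity: viewed in the dual of the separable space L^q, the sequence has a weak* convergent
  -- subsequence. The limit comes from L^p, and testing with L^q exhausts all functionals on L^p.
  let B : Lp ℝ p μ →L[ℝ] StrongDual ℝ (Lp ℝ q μ) := (ContinuousLinearMap.mul ℝ ℝ).lpPairing μ p q
  obtain ⟨Λ, k, hk, h⟩ := exists_subseq_weakStar (fun n => B (f n)) (‖B‖ * C) fun n =>
    (B.le_opNorm _).trans (by gcongr; exact hf n)
  obtain ⟨g, rfl⟩ := exists_eq_dualPairing (p := q) (q := p) hq hp Λ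
  refine ⟨g, k, hk, fun φ => ?_⟩
  obtain ⟨ψ, rfl⟩ := exists_eq_dualPairing (p := p) (q := q) hp hq φ
  have key : ∀ f : Lp ℝ p μ, (dualPairing ψ : StrongDual ℝ (Lp ℝ p μ)) f = dualPairing f ψ := by
    intro f
    simp only [dualPairing_apply, mul_comm]
  simp only [key]
  exact h ψ

end Duality

/-! ### Lower limits of sums and of dual norms. -/

section LowerLimits

theorem add_liminf_le_liminf_add (f g : ℕ → ℝ≥0∞) :
    liminf f atTop + liminf g atTop ≤ liminf (fun n => f n + g n) atTop := by
  simp only [liminf_eq_iSup_iInf_of_nat]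
  have hmono : ∀ h : ℕ → ℝ≥0∞, Monotone fun n => ⨅ i, ⨅ (_ : i ≥ n), h i := fun h m n hmn =>
    biInf_mono fun i hi => hmn.trans hi
  rw [ENNReal.iSup_add_iSup_of_monotone (hmono f) (hmono g)]
  refine iSup_mono fun n => le_iInf₂ fun i hi => ?_
  exact add_le_add (iInf₂_le i hi) (iInf₂_le i hi)

theorem sum_liminf_le_liminf_sum {ι : Type*} (s : Finset ι) (f : ι → ℕ → ℝ≥0∞) :
    ∑ i ∈ s, liminf (f i) atTop ≤ liminf (fun n => ∑ i ∈ s, f i n) atTop := by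
  classical
  induction s using Finset.induction_on with
  | empty => simp
  | insert i s hi ih =>
    simp only [Finset.sum_insert hi]
    exact (add_le_add_right ih _).trans (add_liminf_le_liminf_add _ _)

/-- The dual norm is weak* sequentially lower semicontinuous. -/
theorem enorm_le_liminf_of_weakStar {E : Type*} [NormedAddCommGroup E] [NormedSpace ℝ E]
    {f : ℕ → StrongDual ℝ E} {g : StrongDual ℝ E}
    (h : ∀ x, Tendsto (fun n => f n x) atTop (𝓝 (g x))) :
    ‖g‖ₑ ≤ liminf (fun n => ‖f n‖ₑ) atTop := by
  by_contra! hlt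
  obtain ⟨b, hb1, hb2⟩ := exists_between hlt
  have hfr := frequently_lt_of_liminf_lt (by isBoundedDefault) hb1
  lift b to ℝ≥0 using (hb2.trans_le le_top).ne
  refine absurd hb2 (not_lt.mpr ?_)
  rw [enorm_eq_nnnorm, ENNReal.coe_le_coe, ← NNReal.coe_le_coe, coe_nnnorm]
  refine g.opNorm_le_bound b.2 fun x => ?_
  refine le_of_tendsto_of_frequently (h x).norm (hfr.mono fun n hn => ?_)
  refine ((f n).le_opNorm x).trans ?_
  gcongr
  rw [enorm_eq_nnnorm, ENNReal.coe_lt_coe, ← NNReal.coe_lt_coe, coe_nnnorm] at hn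
  exact hn.le

/-- Weak* convergence tested against a strongly convergent sequence. -/
theorem tendsto_apply_of_weakStar {E : Type*} [NormedAddCommGroup E] [NormedSpace ℝ E]
    {f : ℕ → StrongDual ℝ E} {g : StrongDual ℝ E}
    (h : ∀ x, Tendsto (fun n => f n x) atTop (𝓝 (g x))) {C : ℝ} (hC : ∀ n, ‖f n‖ ≤ C)
    {x : ℕ → E} {x₀ : E} (hx : Tendsto x atTop (𝓝 x₀)) :
    Tendsto (fun n => f n (x n)) atTop (𝓝 (g x₀)) := by
  have h0 : Tendsto (fun n => f n (x n - x₀)) atTop (𝓝 0) := by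
    have hn : Tendsto (fun n => C * ‖x n - x₀‖) atTop (𝓝 0) := by
      simpa using (tendsto_iff_norm_sub_tendsto_zero.mp hx).const_mul C
    refine squeeze_zero_norm (fun n => ?_) hn
    refine ((f n).le_opNorm _).trans ?_
    gcongr
    exact hC n
  simpa using h0.add (h x₀)

end LowerLimits

/-! ### Continuity and norm bounds of the convolution. -/

section MeasureFacts

theorem exists_norm_toLp_le {α : Type*} [MeasurableSpace α] (μ : Measure α) [IsFiniteMeasure μ]
    {p q : ℝ≥0∞} (hp : 1 ≤ p) (hpq : p ≤ q) : ∃ c : ℝ, 0 ≤ c ∧ ∀ (g : Lp ℝ q μ) (hg : MemLp g p μ),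
      ‖hg.toLp g‖ ≤ c * ‖g‖ := by
  have he : 0 ≤ 1 / p.toReal - 1 / q.toReal := by
    -- Here `∞.toReal = 0` and `1 / 0 = 0`, so `1 / q.toReal` has the right value also for `q = ∞`.
    by_cases hq : q = ∞
    · simp [hq]
    · refine sub_nonneg.mpr (one_div_le_one_div_of_le ?_ (ENNReal.toReal_mono hq hpq))
      exact ENNReal.toReal_pos (one_pos.trans_le hp).ne' (ne_top_of_le_ne_top hq hpq)
  refine ⟨(μ Set.univ ^ (1 / p.toReal - 1 / q.toReal)).toReal, ENNReal.toReal_nonneg,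
    fun g hg => ?_⟩
  rw [Lp.norm_toLp, Lp.norm_def, mul_comm, ← ENNReal.toReal_mul]
  refine ENNReal.toReal_mono (ENNReal.mul_ne_top (Lp.eLpNorm_ne_top g) ?_)
    (eLpNorm_le_eLpNorm_mul_rpow_measure_univ hpq (Lp.aestronglyMeasurable g))
  exact (ENNReal.rpow_lt_top_of_nonneg he (measure_ne_top _ _)).ne

theorem exists_integral_norm_le {α : Type*} [MeasurableSpace α] (μ : Measure α)
    [IsFiniteMeasure μ] {q : ℝ≥0∞} (hq : 1 ≤ q) :
    ∃ c : ℝ, 0 ≤ c ∧ ∀ g : Lp ℝ q μ, ∫ x, ‖g x‖ ∂μ ≤ c * ‖g‖ := by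
  obtain ⟨c, hc, h⟩ := exists_norm_toLp_le μ le_rfl hq
  refine ⟨c, hc, fun g => ?_⟩
  have hg : MemLp g 1 μ := (Lp.memLp g).mono_exponent hq
  refine le_trans (le_of_eq ?_) (h g hg)
  rw [Lp.norm_toLp, eLpNorm_one_eq_lintegral_enorm,
    ← integral_norm_eq_lintegral_enorm (Lp.aestronglyMeasurable g)]

variable {d : ℕ} {W S : Set (Space d)}

theorem isFiniteMeasure_restrict (hW : Bornology.IsBounded W) :
    IsFiniteMeasure ((volume : Measure (Space d)).restrict W) :=
  ⟨by simpa using hW.measure_lt_top⟩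

/-- `C₀(W)` is separable for bounded open `W`. -/
theorem separableSpace_C0 (hW : IsOpen W) (hWb : Bornology.IsBounded W) :
    TopologicalSpace.SeparableSpace (C0 W) := by
  have : CompactSpace (closure W) := isCompact_iff_compactSpace.mp hWb.isCompact_closure
  -- Extension by zero embeds `C₀(W)` isometrically into the continuous functions on a compact
  -- metric space. That space is second countable, a property that subspaces inherit.
  let i : C0 W →ₗ[ℝ] C(closure W, ℝ) :=
    { toFun := fun φ => ⟨fun x => zeroExt φ x, (continuous_zeroExt hW φ).comp (by fun_prop)⟩
      map_add' := fun φ ψ => by ext x; exact zeroExt_add φ ψ x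
      map_smul' := fun c φ => by ext x; exact zeroExt_smul c φ x }
  have hi : Isometry i := by
    refine AddMonoidHomClass.isometry_of_norm i fun φ => le_antisymm ?_ ?_
    · exact (ContinuousMap.norm_le _ (norm_nonneg _)).mpr fun x => abs_zeroExt_le φ x
    · rw [← ZeroAtInftyContinuousMap.norm_toBCF_eq_norm]
      refine (BoundedContinuousFunction.norm_le (norm_nonneg _)).mpr fun x => ?_
      refine le_trans (le_of_eq ?_) ((i φ).norm_coe_le_norm ⟨x, subset_closure x.2⟩)
      exact congrArg norm (zeroExt_of_mem φ x.2).symm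
  have : SecondCountableTopology (C0 W) := hi.isUniformInducing.isInducing.secondCountableTopology
  infer_instance

theorem uniformContinuous_zeroExt (hW : IsOpen W) (φ : C0 W) : UniformContinuous (zeroExt φ) := by
  refine (continuous_zeroExt hW φ).uniformContinuous_of_tendsto_cocompact (x := 0) ?_
  rw [Metric.tendsto_nhds]
  intro ε hε
  obtain ⟨K, hK, -, h⟩ := exists_compact_zeroExt φ hε
  filter_upwards [hK.compl_mem_cocompact] with x hx
  simpa using h x hx

/-- Testing with `φ ∈ C₀(W)` is a continuous functional on `L^q(W)`. -/
theorem exists_dual_eq_integral_zeroExt {q : ℝ≥0∞} [Fact (1 ≤ q)] (hW : IsOpen W)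
    (hWb : Bornology.IsBounded W) (φ : C0 W) :
    ∃ Λ : StrongDual ℝ (LpOn q W), ∀ w, Λ w = ∫ x in W, w x * zeroExt φ x := by
  have := isFiniteMeasure_restrict hWb
  obtain ⟨c, hc, h⟩ := exists_integral_norm_le ((volume : Measure (Space d)).restrict W)
    (q := q) Fact.out
  have hi : ∀ w : LpOn q W, Integrable w ((volume : Measure (Space d)).restrict W) := fun w =>
    (Lp.memLp w).integrable Fact.out
  have hint : ∀ w : LpOn q W, Integrable (fun x => w x * zeroExt φ x)
      ((volume : Measure (Space d)).restrict W) := fun w =>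
    (hi w).mul_bdd (c := ‖φ‖) (continuous_zeroExt hW φ).aestronglyMeasurable
      (ae_of_all _ fun x => abs_zeroExt_le φ x)
  refine ⟨LinearMap.mkContinuous
    { toFun := fun w => ∫ x in W, w x * zeroExt φ x
      map_add' := fun w₁ w₂ => by
        rw [← integral_add (hint w₁) (hint w₂)]
        refine integral_congr_ae ?_
        filter_upwards [Lp.coeFn_add w₁ w₂] with x hx
        rw [hx, Pi.add_apply, add_mul]
      map_smul' := fun c w => by
        rw [RingHom.id_apply, smul_eq_mul, ← integral_const_mul]
        refine integral_congr_ae ?_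
        filter_upwards [Lp.coeFn_smul c w] with x hx
        rw [hx, Pi.smul_apply, smul_eq_mul, mul_assoc] } (‖φ‖ * c) fun w => ?_, fun w => rfl⟩
  change ‖∫ x in W, w x * zeroExt φ x‖ ≤ _
  rw [mul_assoc]
  refine le_trans ?_ (mul_le_mul_of_nonneg_left (h w) (norm_nonneg φ))
  rw [← integral_const_mul]
  refine norm_integral_le_of_norm_le ((hi w).norm.const_mul _) (ae_of_all _ fun x => ?_)
  rw [norm_mul, mul_comm]
  exact mul_le_mul_of_nonneg_right (abs_zeroExt_le φ x) (norm_nonneg _)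

theorem innerInt_add (hW : IsOpen W) (hSb : Bornology.IsBounded S) (g h : LpOn 2 S) (φ : C0 W)
    (y : Space d) : innerInt (g + h) φ y = innerInt g φ y + innerInt h φ y := by
  unfold innerInt
  rw [← integral_add (integrable_zeroExt_mul hW hSb g φ y) (integrable_zeroExt_mul hW hSb h φ y)]
  refine integral_congr_ae ?_
  filter_upwards [Lp.coeFn_add g h] with x hx
  rw [hx, Pi.add_apply, mul_add]

theorem innerInt_smul (c : ℝ) (g : LpOn 2 S) (φ : C0 W) (y : Space d) :
    innerInt (c • g) φ y = c * innerInt g φ y := by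
  unfold innerInt
  rw [← integral_const_mul]
  refine integral_congr_ae ?_
  filter_upwards [Lp.coeFn_smul c g] with x hx
  rw [hx, Pi.smul_apply, smul_eq_mul, mul_left_comm]

/-- The inner integral as a functional of the kernel. -/
def innerIntDual (hW : IsOpen W) (hWb : Bornology.IsBounded W) (hSb : Bornology.IsBounded S)
    (φ : C0 W) (y : Space d) : StrongDual ℝ (LpOn 2 S) :=
  LinearMap.mkContinuous
    { toFun := fun g => innerInt g φ y
      map_add' := fun g h => innerInt_add hW hSb g h φ y
      map_smul' := fun c g => innerInt_smul c g φ y } ‖toL2 hW hWb φ‖ fun g => by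
    rw [mul_comm]
    exact abs_innerInt_le_L2 hW hWb g φ y

/-- Since `‖g‖₁ ≤ c ‖g‖₂`, the modulus of continuity of the extended test function serves all
kernels in a ball at once. This equicontinuity is what upgrades pointwise to uniform convergence in
`tendsto_convAdj`. -/
theorem exists_modulus_innerInt (hW : IsOpen W) (hSb : Bornology.IsBounded S)
    (φ : C0 W) (C : ℝ) {ε : ℝ} (hε : 0 < ε) : ∃ δ > 0, ∀ g : LpOn 2 S, ‖g‖ ≤ C →
      ∀ y y', dist y y' < δ → |innerInt g φ y - innerInt g φ y'| ≤ ε := by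
  have := isFiniteMeasure_restrict hSb
  obtain ⟨c, hc, h⟩ := exists_integral_norm_le ((volume : Measure (Space d)).restrict S)
    (q := 2) (by norm_num)
  -- The `+ 1` keeps the denominator positive when `c * |C| = 0`; the absolute value is there
  -- because the sign of `C` is not known.
  have hpos : 0 < ε / (c * |C| + 1) := by positivity
  obtain ⟨δ, hδ, hu⟩ := Metric.uniformContinuous_iff.mp (uniformContinuous_zeroExt hW φ) _ hpos
  refine ⟨δ, hδ, fun g hg y y' hy => ?_⟩
  have hb : |innerInt g φ y - innerInt g φ y'| ≤ ε / (c * |C| + 1) * ∫ x in S, ‖g x‖ := by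
    unfold innerInt
    rw [← integral_sub (integrable_zeroExt_mul hW hSb g φ y)
      (integrable_zeroExt_mul hW hSb g φ y'), ← integral_const_mul, ← Real.norm_eq_abs]
    refine norm_integral_le_of_norm_le ((integrable_kernel hSb g).norm.const_mul _)
      (ae_of_all _ fun x => ?_)
    rw [← sub_mul, norm_mul]
    refine mul_le_mul_of_nonneg_right ?_ (norm_nonneg _)
    have := hu (a := x + y) (b := x + y') (by simpa using hy)
    rw [Real.dist_eq] at this
    exact this.le
  refine hb.trans ?_
  have h2 : ∫ x in S, ‖g x‖ ≤ c * |C| + 1 :=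
    (h g).trans ((mul_le_mul_of_nonneg_left (hg.trans (le_abs_self C)) hc).trans (by linarith))
  calc ε / (c * |C| + 1) * ∫ x in S, ‖g x‖ ≤ ε / (c * |C| + 1) * (c * |C| + 1) := by gcongr
    _ = ε := div_mul_cancel₀ _ (by positivity)

/-- `g ↦ convAdj g φ` maps bounded weakly convergent sequences to norm convergent ones. -/
theorem tendsto_convAdj (hW : IsOpen W) (hWb : Bornology.IsBounded W) (hS : IsOpen S)
    (hSb : Bornology.IsBounded S) {g : ℕ → LpOn 2 S} {g₀ : LpOn 2 S} (hg : WeakTendsto g g₀)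
    {C : ℝ} (hC : ∀ n, ‖g n‖ ≤ C) (φ : C0 W) :
    Tendsto (fun n => convAdj hW hS hSb (g n) φ) atTop (𝓝 (convAdj hW hS hSb g₀ φ)) := by
  rw [Metric.tendsto_nhds]
  intro ε hε
  have hε4 : 0 < ε / 4 := by positivity
  -- The radius includes `‖g₀‖`, so that the modulus also serves the limit. Weak convergence then
  -- gives smallness on a finite δ-net of the compact closure, and the modulus carries it to all
  -- points.
  obtain ⟨δ, hδ, hmod⟩ := exists_modulus_innerInt (S := S) hW hSb φ (max C ‖g₀‖) hε4
  have hTb : IsCompact (closure (W - S)) := (hWb.sub hSb).isCompact_closure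
  obtain ⟨t, -, htf, htc⟩ := hTb.finite_cover_balls hδ
  have hev : ∀ᶠ n in atTop, ∀ y ∈ t, |innerInt (g n) φ y - innerInt g₀ φ y| < ε / 4 := by
    rw [eventually_all_finite htf]
    intro y _
    have := Metric.tendsto_nhds.mp (hg (innerIntDual hW hWb hSb φ y)) _ hε4
    exact this.mono fun n hn => by rw [Real.dist_eq] at hn; exact hn
  filter_upwards [hev] with n hn
  rw [dist_eq_norm, ← ZeroAtInftyContinuousMap.norm_toBCF_eq_norm]
  -- Three errors of `ε / 4` each: the bound on the supremum is not strict, and the fourth quarter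
  -- makes it so.
  refine lt_of_le_of_lt ((BoundedContinuousFunction.norm_le (C := 3 * (ε / 4))
    (by positivity)).mpr fun y => ?_) (by linarith)
  change |innerInt (g n) φ y - innerInt g₀ φ y| ≤ _
  obtain ⟨z, hz, hyz⟩ := Set.mem_iUnion₂.mp (htc (subset_closure y.2))
  have h1 := hmod (g n) ((hC n).trans (le_max_left _ _)) _ _ hyz
  have h2 := hmod g₀ (le_max_right _ _) _ _ hyz
  have h3 := hn z hz
  rw [abs_le] at *
  rw [abs_lt] at h3
  constructor <;> linarith [h1.1, h1.2, h2.1, h2.2, h3.1, h3.2]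

/-- Sequential continuity of the convolution. -/
theorem tendsto_conv (hW : IsOpen W) (hWb : Bornology.IsBounded W) (hS : IsOpen S)
    (hSb : Bornology.IsBounded S) {μ : ℕ → Radon (W - S)} {μ₀ : Radon (W - S)}
    (hμ : ∀ φ, Tendsto (fun n => μ n φ) atTop (𝓝 (μ₀ φ))) {C : ℝ} (hμC : ∀ n, ‖μ n‖ ≤ C)
    {g : ℕ → LpOn 2 S} {g₀ : LpOn 2 S} (hg : WeakTendsto g g₀) {C' : ℝ} (hC : ∀ n, ‖g n‖ ≤ C')
    (φ : C0 W) :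
    Tendsto (fun n => conv hW hS hSb (μ n) (g n) φ) atTop (𝓝 (conv hW hS hSb μ₀ g₀ φ)) :=
  tendsto_apply_of_weakStar hμ hμC (tendsto_convAdj hW hWb hS hSb hg hC φ)

theorem represents_convLq {q : ℝ≥0∞} (hq : q ≤ 2) (hW : IsOpen W)
    (hWb : Bornology.IsBounded W) (hS : IsOpen S) (hSb : Bornology.IsBounded S)
    (μ : Radon (W - S)) (g : LpOn 2 S) :
    Represents (convLq q hW hS hSb μ g) (conv hW hS hSb μ g) :=
  Classical.epsilon_spec (exists_represents_conv hq hW hWb hS hSb μ g)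

theorem represents_zero {q : ℝ≥0∞} : Represents (0 : LpOn q W) (0 : Radon W) := by
  intro φ
  rw [zero_apply, ← integral_zero (Space d) ℝ]
  refine integral_congr_ae ?_
  filter_upwards [Lp.coeFn_zero ℝ q ((volume : Measure (Space d)).restrict W)] with x hx
  rw [hx, Pi.zero_apply, zero_mul]

theorem inner_toL2 (hW : IsOpen W) (hWb : Bornology.IsBounded W) (w : LpOn 2 W) (φ : C0 W) :
    inner ℝ w (toL2 hW hWb φ) = ∫ x in W, w x * zeroExt φ x := by
  rw [L2.inner_def]
  refine integral_congr_ae ?_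
  filter_upwards [(memLp_zeroExt hW hWb φ).coeFn_toLp] with x hx
  have hx' : (toL2 hW hWb φ : LpOn 2 W) x = zeroExt φ x := hx
  rw [hx']
  simp [mul_comm]

/-- A function orthogonal to the range represents the zero measure, hence vanishes by
`Represents.unique`. -/
theorem dense_range_toL2 (hW : IsOpen W) (hWb : Bornology.IsBounded W) :
    DenseRange (toL2 hW hWb) := by
  have : (LinearMap.range (toL2 hW hWb)).topologicalClosure = ⊤ := by
    rw [Submodule.topologicalClosure_eq_top_iff, Submodule.eq_bot_iff]
    intro w hw
    refine Represents.unique (ρ := 0) hW hWb (fun φ => ?_) represents_zero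
    rw [← inner_toL2 hW hWb, real_inner_comm]
    exact (Submodule.mem_orthogonal _ _).mp hw _ ⟨φ, rfl⟩
  exact Submodule.dense_iff_topologicalClosure_eq_top.mpr this

/-- The bound is proved for an L² representative and then transferred to L^q, as `W` has finite
measure. `convLq` is only some chosen representative, so uniqueness is needed to identify the two.
-/
theorem exists_norm_convLq_le {q : ℝ≥0∞} [Fact (1 ≤ q)] (hq : q ≤ 2) (hW : IsOpen W)
    (hWb : Bornology.IsBounded W) (hS : IsOpen S) (hSb : Bornology.IsBounded S) :
    ∃ c : ℝ, 0 ≤ c ∧ ∀ (μ : Radon (W - S)) (g : LpOn 2 S),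
      ‖convLq q hW hS hSb μ g‖ ≤ c * (‖μ‖ * ‖g‖) := by
  have := isFiniteMeasure_restrict hWb
  obtain ⟨c, hc, h⟩ := exists_norm_toLp_le ((volume : Measure (Space d)).restrict W)
    (Fact.out : 1 ≤ q) hq
  refine ⟨c, hc, fun μ g => ?_⟩
  obtain ⟨w, hw⟩ := exists_represents_conv le_rfl hW hWb hS hSb μ g
  have hm : MemLp w q ((volume : Measure (Space d)).restrict W) := (Lp.memLp w).mono_exponent hq
  have hrep : Represents (hm.toLp w) (conv hW hS hSb μ g) := by
    intro φ
    rw [← hw φ]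
    refine integral_congr_ae ?_
    filter_upwards [hm.coeFn_toLp] with x hx
    rw [hx]
  rw [(represents_convLq hq hW hWb hS hSb μ g).unique hW hWb hrep]
  refine (h w hm).trans (mul_le_mul_of_nonneg_left ?_ hc)
  -- Young's bound for test functions extends to all of L² by density; taking `x = w` then gives the
  -- norm of `w`.
  have hin : ∀ x : LpOn 2 W, inner ℝ w x ≤ ‖μ‖ * ‖g‖ * ‖x‖ := by
    intro x
    refine (dense_range_toL2 hW hWb).induction_on x ?_ fun φ => ?_
    · exact isClosed_le (by fun_prop) (by fun_prop)
    · rw [inner_toL2, hw φ]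
      have h1 : |conv hW hS hSb μ g φ| ≤ ‖μ‖ * ‖convAdj hW hS hSb g φ‖ := μ.le_opNorm _
      have h2 : ‖convAdj hW hS hSb g φ‖ ≤ ‖g‖ * ‖toL2 hW hWb φ‖ := by
        rw [← ZeroAtInftyContinuousMap.norm_toBCF_eq_norm]
        exact (BoundedContinuousFunction.norm_le (by positivity)).mpr fun y =>
          abs_innerInt_le_L2 hW hWb g φ y
      rw [mul_assoc]
      exact (le_abs_self _).trans (h1.trans (mul_le_mul_of_nonneg_left h2 (norm_nonneg μ)))
  have hself := hin w
  rw [real_inner_self_eq_norm_mul_norm] at hself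
  rcases (norm_nonneg w).eq_or_lt with h0 | h0
  · rw [← h0]; positivity
  · exact le_of_mul_le_mul_right hself h0

end MeasureFacts

/-! ### Weak limits and simultaneous subsequences. -/

section Weak

variable {E F : Type*} [NormedAddCommGroup E] [NormedSpace ℝ E] [NormedAddCommGroup F]
  [NormedSpace ℝ F]

theorem WeakTendsto.comp_strictMono {x : ℕ → E} {x₀ : E} (h : WeakTendsto x x₀) {k : ℕ → ℕ}
    (hk : StrictMono k) : WeakTendsto (fun n => x (k n)) x₀ := fun f =>
  (h f).comp hk.tendsto_atTop

/-- Test with a Hahn–Banach functional that norms the limit. This preserves the constraint on the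
kernels. -/
theorem WeakTendsto.norm_le {x : ℕ → E} {x₀ : E} (h : WeakTendsto x x₀) {C : ℝ}
    (hC : ∀ n, ‖x n‖ ≤ C) : ‖x₀‖ ≤ C := by
  obtain ⟨g, hg, hgx⟩ := exists_dual_vector'' ℝ x₀
  have hlim := h g
  rw [hgx] at hlim
  refine le_of_tendsto hlim (Eventually.of_forall fun n => ?_)
  exact (le_abs_self _).trans ((g.le_opNorm _).trans
    ((mul_le_of_le_one_left (norm_nonneg _) hg).trans (hC n)))

/-- Simultaneous extraction of subsequences for finitely many properties. -/
theorem exists_subseq_forall {ι : Type*} [Finite ι] (Q : ι → (ℕ → ℕ) → Prop)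
    (hex : ∀ i (k : ℕ → ℕ), StrictMono k → ∃ k' : ℕ → ℕ, StrictMono k' ∧ Q i (k ∘ k'))
    (hsub : ∀ i (k k' : ℕ → ℕ), StrictMono k' → Q i k → Q i (k ∘ k')) :
    ∃ k : ℕ → ℕ, StrictMono k ∧ ∀ i, Q i k := by
  classical
  have := Fintype.ofFinite ι
  suffices h : ∀ s : Finset ι, ∃ k : ℕ → ℕ, StrictMono k ∧ ∀ i ∈ s, Q i k by
    obtain ⟨k, hk, h⟩ := h Finset.univ
    exact ⟨k, hk, fun i => h i (Finset.mem_univ i)⟩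
  intro s
  induction s using Finset.induction_on with
  | empty => exact ⟨id, strictMono_id, by simp⟩
  | insert i s _ ih =>
    obtain ⟨k, hk, h⟩ := ih
    obtain ⟨k', hk', h'⟩ := hex i k hk
    refine ⟨k ∘ k', hk.comp hk', fun j hj => ?_⟩
    rcases Finset.mem_insert.mp hj with rfl | hj
    · exact h'
    · exact hsub j k k' hk' (h j hj)

end Weak

/-! ### Weak lower semicontinuity and coercivity of the generative prior. -/

section Prior

variable {d : ℕ} {X : Geometry d} {a : Architecture}

theorem Geometry.isBounded_layer (X : Geometry d) : ∀ l, Bornology.IsBounded (X.layer l)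
  | 0 => X.domain_Ω.isBounded
  | l + 1 => (X.isBounded_layer l).sub X.domain_S.isBounded

theorem tendsto_layerConv (j : Fin (a.depth + 1)) {μ : ℕ → LatentLayer X a ((j : ℕ) + 1)}
    {μ₀ : LatentLayer X a ((j : ℕ) + 1)} (hμ : WeakStarTendsto μ μ₀) {C : ℝ}
    (hC : ∀ m n, ‖μ m n‖ ≤ C) {θ : ℕ → KernelLayer X a j} {θ₀ : KernelLayer X a j}
    (hθ : ∀ e, WeakTendsto (fun m => θ m e) (θ₀ e)) {C' : ℝ} (hC' : ∀ m e, ‖θ m e‖ ≤ C') :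
    WeakStarTendsto (fun m => layerConv j (μ m) (θ m)) (layerConv j μ₀ θ₀) := by
  intro k φ
  simp only [layerConv, _root_.sum_apply]
  refine tendsto_finsetSum _ fun e _ => ?_
  by_cases h : e.1.2 = k
  · simp only [h, if_true]
    exact tendsto_conv (X.isOpen_layer j) (X.isBounded_layer j) X.domain_S.isOpen
      X.domain_S.isBounded (hμ e.1.1) (fun m => hC m _) (hθ e) (fun m => hC' m e) φ
  · simp only [h, if_false]
    exact tendsto_const_nhds

theorem tendsto_layerMismatch (j : Fin a.depth) {μ : ℕ → Latent X a} {μ₀ : Latent X a}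
    (hμ : ∀ j, WeakStarTendsto (fun m => μ m j) (μ₀ j)) {C : ℝ}
    (hC : ∀ m j n, ‖μ m j n‖ ≤ C) {θ : ℕ → Kernels X a} {θ₀ : Kernels X a}
    (hθ : ∀ j e, WeakTendsto (fun m => θ m j e) (θ₀ j e)) {C' : ℝ}
    (hC' : ∀ m j e, ‖θ m j e‖ ≤ C') :
    WeakStarTendsto (fun m => layerMismatch j (μ m) (θ m)) (layerMismatch j μ₀ θ₀) := by
  intro k φ
  exact (hμ j.castSucc k φ).sub (tendsto_layerConv j.succ (hμ j.succ) (fun m => hC m j.succ)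
    (hθ j.succ) (fun m => hC' m j.succ) k φ)

theorem networkEnergy_le_liminf {J : (j : Fin a.depth) → LatentLayer X a ((j : ℕ) + 1) → ℝ≥0∞}
    (hJ : PenaltyAssumption J) {μ : ℕ → Latent X a} {μ₀ : Latent X a}
    (hμ : ∀ j, WeakStarTendsto (fun m => μ m j) (μ₀ j)) {C : ℝ}
    (hC : ∀ m j n, ‖μ m j n‖ ≤ C) {θ : ℕ → Kernels X a} {θ₀ : Kernels X a}
    (hθ : ∀ j e, WeakTendsto (fun m => θ m j e) (θ₀ j e)) {C' : ℝ}
    (hC' : ∀ m j e, ‖θ m j e‖ ≤ C') :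
    networkEnergy J μ₀ θ₀ ≤ liminf (fun m => networkEnergy J (μ m) (θ m)) atTop := by
  refine le_trans (add_le_add ?_ ?_) (add_liminf_le_liminf_add _ _)
  · refine le_trans (Finset.sum_le_sum fun j _ => ?_) (sum_liminf_le_liminf_sum _ _)
    refine le_trans (Finset.sum_le_sum fun n _ => ?_) (sum_liminf_le_liminf_sum _ _)
    exact enorm_le_liminf_of_weakStar (hμ j n)
  · refine le_trans (Finset.sum_le_sum fun j _ => ?_) (sum_liminf_le_liminf_sum _ _)
    exact hJ.lsc j _ _ (tendsto_layerMismatch j hμ hC hθ hC')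

theorem enorm_le_networkEnergy
    (J : (j : Fin a.depth) → LatentLayer X a ((j : ℕ) + 1) → ℝ≥0∞)
    (μ : Latent X a) (θ : Kernels X a) (j : Fin (a.depth + 1)) (n : Fin (a.N ((j : ℕ) + 1))) :
    ‖μ j n‖ₑ ≤ networkEnergy J μ θ := by
  refine le_trans ?_ (le_add_right (le_refl (∑ j, ∑ n, ‖μ j n‖ₑ)))
  refine le_trans ?_ (Finset.single_le_sum (f := fun j => ∑ n, ‖μ j n‖ₑ)
    (fun _ _ => zero_le) (Finset.mem_univ j))
  exact Finset.single_le_sum (f := fun n => ‖μ j n‖ₑ) (fun _ _ => zero_le) (Finset.mem_univ n)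

variable {q : ℝ≥0∞} [Fact (1 ≤ q)]

/-- The output constraint is closed: tested with `φ ∈ C₀(Ω)`, the outputs converge both to the
pairing with `v`, by weak convergence, and to that with the limit convolution, by `tendsto_conv`. So
both sides represent the same measure. -/
theorem eq_outputConv_of_weakTendsto (hq : q ≤ 2) {μ : ℕ → LatentLayer X a 1}
    {μ₀ : LatentLayer X a 1} (hμ : WeakStarTendsto μ μ₀) {C : ℝ}
    (hC : ∀ m n, ‖μ m n‖ ≤ C) {θ : ℕ → KernelLayer X a a.first} {θ₀ : KernelLayer X a a.first}
    (hθ : ∀ e, WeakTendsto (fun m => θ m e) (θ₀ e)) {C' : ℝ} (hC' : ∀ m e, ‖θ m e‖ ≤ C')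
    {v : LpOn q X.Ω} (hv : WeakTendsto (fun m => outputConv q (μ m) (θ m)) v) :
    v = outputConv q μ₀ θ₀ := by
  have hΩ := X.domain_Ω
  have hS := X.domain_S
  have hrep : ∀ (ν : LatentLayer X a 1) (η : KernelLayer X a a.first) (φ : C0 X.Ω)
      (Λ : StrongDual ℝ (LpOn q X.Ω)), (∀ w, Λ w = ∫ x in X.Ω, w x * zeroExt φ x) →
      Λ (outputConv q ν η)
        = ∑ e : a.conn a.first, conv hΩ.isOpen hS.isOpen hS.isBounded (ν e.1.1) (η e) φ := by
    intro ν η φ Λ hΛ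
    rw [outputConv, map_sum]
    refine Finset.sum_congr rfl fun e _ => ?_
    rw [hΛ]
    exact represents_convLq hq hΩ.isOpen hΩ.isBounded hS.isOpen hS.isBounded _ _ φ
  refine Represents.unique
    (ρ := ∑ e : a.conn a.first, conv hΩ.isOpen hS.isOpen hS.isBounded (μ₀ e.1.1) (θ₀ e))
    hΩ.isOpen hΩ.isBounded (fun φ => ?_) fun φ => ?_
  · obtain ⟨Λ, hΛ⟩ := exists_dual_eq_integral_zeroExt (q := q) hΩ.isOpen hΩ.isBounded φ
    rw [← hΛ, _root_.sum_apply]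
    refine tendsto_nhds_unique (hv Λ) ?_
    simp only [hrep _ _ φ Λ hΛ]
    exact tendsto_finsetSum _ fun e _ => tendsto_conv hΩ.isOpen hΩ.isBounded hS.isOpen
      hS.isBounded (hμ e.1.1) (fun m => hC m _) (hθ e) (fun m => hC' m e) φ
  · obtain ⟨Λ, hΛ⟩ := exists_dual_eq_integral_zeroExt (q := q) hΩ.isOpen hΩ.isBounded φ
    rw [← hΛ, _root_.sum_apply, hrep _ _ φ Λ hΛ]

theorem exists_subseq_latent (μ : ℕ → Latent X a) (C : ℝ) (hC : ∀ m j n, ‖μ m j n‖ ≤ C) :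
    ∃ k : ℕ → ℕ, StrictMono k ∧ ∃ μ₀ : Latent X a,
      ∀ j, WeakStarTendsto (fun m => μ (k m) j) (μ₀ j) := by
  obtain ⟨k, hk, h⟩ := exists_subseq_forall
    (ι := Σ j : Fin (a.depth + 1), Fin (a.N ((j : ℕ) + 1)))
    (fun i k => ∃ ν : Radon (X.layer ((i.1 : ℕ) + 1)),
      ∀ φ, Tendsto (fun m => μ (k m) i.1 i.2 φ) atTop (𝓝 (ν φ)))
    (fun i k hk => by
      have := separableSpace_C0 (X.isOpen_layer ((i.1 : ℕ) + 1)) (X.isBounded_layer _)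
      obtain ⟨ν, k', hk', h⟩ := exists_subseq_weakStar (fun m => μ (k m) i.1 i.2) C
        fun m => hC _ _ _
      exact ⟨k', hk', ν, h⟩)
    (fun i k k' hk' ⟨ν, h⟩ => ⟨ν, fun φ => (h φ).comp hk'.tendsto_atTop⟩)
  choose ν hν using h
  exact ⟨k, hk, fun j n => ν ⟨j, n⟩, fun j n φ => hν ⟨j, n⟩ φ⟩

theorem exists_subseq_kernels (θ : ℕ → Kernels X a) (C : ℝ) (hC : ∀ m j e, ‖θ m j e‖ ≤ C) :
    ∃ k : ℕ → ℕ, StrictMono k ∧ ∃ θ₀ : Kernels X a,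
      ∀ j e, WeakTendsto (fun m => θ (k m) j e) (θ₀ j e) := by
  obtain ⟨k, hk, h⟩ := exists_subseq_forall
    (ι := Σ j : Fin (a.depth + 1), a.conn j)
    (fun i k => ∃ g : LpOn 2 X.S, WeakTendsto (fun m => θ (k m) i.1 i.2) g)
    (fun i k hk => by
      have := isFiniteMeasure_restrict X.domain_S.isBounded
      obtain ⟨g, k', hk', h⟩ := exists_subseq_weakTendsto_Lp (p := 2) (by norm_num) (by norm_num)
        (fun m => θ (k m) i.1 i.2) C fun m => hC _ _ _
      exact ⟨k', hk', g, h⟩)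
    (fun i k k' hk' ⟨g, h⟩ => ⟨g, h.comp_strictMono hk'⟩)
  choose g hg using h
  exact ⟨k, hk, fun j e => g ⟨j, e⟩, fun j e => hg ⟨j, e⟩⟩

/-- A functional on a finite product is a sum of functionals of the components. This lets the
constraint `Z θ = 0` pass to the limit. -/
theorem weakTendsto_kernels {θ : ℕ → Kernels X a} {θ₀ : Kernels X a}
    (h : ∀ j e, WeakTendsto (fun m => θ m j e) (θ₀ j e)) : WeakTendsto θ θ₀ := by
  intro f
  have hf : ∀ η : Kernels X a, f η = ∑ j, ∑ e, (f.comp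
      ((ContinuousLinearMap.single ℝ (fun j => KernelLayer X a j) j).comp
        (ContinuousLinearMap.single ℝ (fun _ : a.conn j => LpOn 2 X.S) e))) (η j e) := by
    intro η
    conv_lhs => rw [← Finset.univ_sum_single η, map_sum]
    refine Finset.sum_congr rfl fun j _ => ?_
    conv_lhs => rw [← Finset.univ_sum_single (η j)]
    change (f.comp (ContinuousLinearMap.single ℝ (fun j => KernelLayer X a j) j)) _ = _
    rw [map_sum]
    rfl
  simp only [hf]
  exact tendsto_finsetSum _ fun j _ => tendsto_finsetSum _ fun e _ => h j e _

/-- The generative prior is weakly sequentially lower semicontinuous. -/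
theorem genPrior_le_liminf (hq : q ≤ 2) {Nc : ℕ} (Z : Kernels X a →L[ℝ] (Fin Nc → ℝ))
    {J : (j : Fin a.depth) → LatentLayer X a ((j : ℕ) + 1) → ℝ≥0∞}
    (hJ : PenaltyAssumption J) {v : ℕ → LpOn q X.Ω} {v₀ : LpOn q X.Ω} (hv : WeakTendsto v v₀) :
    genPrior Z J v₀ ≤ liminf (fun m => genPrior Z J (v m)) atTop := by
  by_contra! hlt
  -- With `b` strictly between the lower limit and the value at `v₀`, infinitely many `v m` have
  -- feasible pairs of energy below `b`, so no minimizing pairs are required. Their limit is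
  -- feasible for `v₀` with energy at most `b`, a contradiction.
  obtain ⟨b, hb1, hb2⟩ := exists_between hlt
  obtain ⟨k, hk, hkb⟩ := extraction_of_frequently_atTop
    (frequently_lt_of_liminf_lt (by isBoundedDefault) hb1)
  have hex : ∀ m, ∃ (μ : Latent X a) (θ : Kernels X a), Feasible Z (v (k m)) μ θ ∧
      networkEnergy J μ θ < b := by
    intro m
    have := hkb m
    simp only [genPrior, iInf_lt_iff] at this
    obtain ⟨μ, θ, h, h'⟩ := this
    exact ⟨μ, θ, h, h'⟩
  choose μ θ hfeas hE using hex
  have hbt : b ≠ ∞ := (hb2.trans_le le_top).ne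
  have hμb : ∀ m j n, ‖μ m j n‖ ≤ b.toReal := by
    intro m j n
    have := (enorm_le_networkEnergy J (μ m) (θ m) j n).trans (hE m).le
    rw [← toReal_enorm]
    exact ENNReal.toReal_mono hbt this
  obtain ⟨k₁, hk₁, μ₀, hμ₀⟩ := exists_subseq_latent μ _ hμb
  obtain ⟨k₂, hk₂, θ₀, hθ₀⟩ := exists_subseq_kernels (fun m => θ (k₁ m)) 1
    fun m j e => (hfeas (k₁ m)).norm_le j e
  have hμ₂ : ∀ j, WeakStarTendsto (fun m => μ (k₁ (k₂ m)) j) (μ₀ j) := fun j n φ =>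
    (hμ₀ j n φ).comp hk₂.tendsto_atTop
  have hθ1 : ∀ m j e, ‖θ (k₁ (k₂ m)) j e‖ ≤ 1 := fun m j e => (hfeas _).norm_le j e
  have hfeas₀ : Feasible Z v₀ μ₀ θ₀ := by
    refine ⟨?_, fun j e => (hθ₀ j e).norm_le fun m => hθ1 m j e, ?_⟩
    · refine eq_outputConv_of_weakTendsto hq (hμ₂ a.first) (fun m n => hμb _ _ _)
        (hθ₀ a.first) (fun m e => hθ1 m a.first e) ?_
      have hvk := hv.comp_strictMono (hk.comp (hk₁.comp hk₂))
      have heq : ∀ m, v ((k ∘ k₁ ∘ k₂) m)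
          = outputConv q (μ (k₁ (k₂ m)) a.first) (θ (k₁ (k₂ m)) a.first) := fun m =>
        (hfeas _).output
      simp only [heq] at hvk
      exact hvk
    · funext c
      have := weakTendsto_kernels hθ₀ ((ContinuousLinearMap.proj c).comp Z)
      refine tendsto_nhds_unique this ?_
      refine tendsto_const_nhds.congr fun m => ?_
      rw [ContinuousLinearMap.comp_apply, (hfeas _).linear]
      rfl
  refine absurd hb2 (not_lt.mpr ?_)
  calc genPrior Z J v₀ ≤ networkEnergy J μ₀ θ₀ := iInf_le_of_le μ₀ (iInf₂_le θ₀ hfeas₀)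
    _ ≤ liminf (fun m => networkEnergy J (μ (k₁ (k₂ m))) (θ (k₁ (k₂ m)))) atTop :=
      networkEnergy_le_liminf hJ hμ₂ (fun m j n => hμb _ _ _) hθ₀ hθ1
    _ ≤ b := liminf_le_of_le (by isBoundedDefault) fun c hc => by
      obtain ⟨m, hm⟩ := hc.exists
      exact hm.trans (hE _).le

/-- The generative prior controls the norm. -/
theorem exists_enorm_le_genPrior (hq : q ≤ 2) {Nc : ℕ} (Z : Kernels X a →L[ℝ] (Fin Nc → ℝ))
    (J : (j : Fin a.depth) → LatentLayer X a ((j : ℕ) + 1) → ℝ≥0∞) :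
    ∃ C : ℝ≥0, ∀ v : LpOn q X.Ω, ‖v‖ₑ ≤ C * genPrior Z J v := by
  obtain ⟨c, hc, hcl⟩ := exists_norm_convLq_le hq X.domain_Ω.isOpen X.domain_Ω.isBounded
    X.domain_S.isOpen X.domain_S.isBounded
  lift c to ℝ≥0 using hc
  -- One summand `c` per connection of the first layer. The `+ 1` makes the constant nonzero: since
  -- `0 * ∞ = 0`, a zero constant would fail where the prior is infinite. It also permits division,
  -- which turns the claim into a lower bound for an infimum, to be checked on each feasible pair.
  refine ⟨Fintype.card (a.conn a.first) * c + 1, fun v => ?_⟩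
  rw [mul_comm]
  refine (ENNReal.div_le_iff_le_mul (Or.inl (by simp)) (Or.inl ENNReal.coe_ne_top)).mp ?_
  refine le_iInf fun μ => le_iInf fun θ => le_iInf fun hf => ?_
  refine (ENNReal.div_le_iff_le_mul (Or.inl (by simp)) (Or.inl ENNReal.coe_ne_top)).mpr ?_
  rw [hf.output, outputConv]
  have hterm : ∀ e : a.conn a.first, ‖convLq q X.domain_Ω.isOpen X.domain_S.isOpen
      X.domain_S.isBounded (μ a.first e.1.1) (θ a.first e)‖ₑ ≤ c * networkEnergy J μ θ := by
    intro e
    refine le_trans ?_ (mul_le_mul_right (enorm_le_networkEnergy J μ θ a.first e.1.1) _)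
    rw [enorm_eq_nnnorm, enorm_eq_nnnorm, ← ENNReal.coe_mul, ENNReal.coe_le_coe,
      ← NNReal.coe_le_coe]
    refine (hcl _ _).trans ?_
    push_cast
    gcongr
    exact mul_le_of_le_one_right (norm_nonneg _) (hf.norm_le a.first e)
  calc _ ≤ ∑ e : a.conn a.first, (c : ℝ≥0∞) * networkEnergy J μ θ :=
        (enorm_sum_le _ _).trans (Finset.sum_le_sum fun e _ => hterm e)
    _ = (Fintype.card (a.conn a.first) * c : ℝ≥0∞) * networkEnergy J μ θ := by
        rw [Finset.sum_const, Finset.card_univ, nsmul_eq_mul, mul_assoc]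
    _ ≤ networkEnergy J μ θ * ((Fintype.card (a.conn a.first) * c + 1 : ℝ≥0) : ℝ≥0∞) := by
        rw [mul_comm]
        gcongr
        push_cast
        exact le_self_add

end Prior

/-! ### Convergence of the summands from convergence of the sum. -/

section LowerLimits

theorem limsup_add_liminf_le_limsup_add (f g : ℕ → ℝ≥0∞) :
    limsup f atTop + liminf g atTop ≤ limsup (fun n => f n + g n) atTop := by
  rw [liminf_eq_iSup_iInf_of_nat (u := g), ENNReal.add_iSup]
  refine iSup_le fun n => ?_
  rw [← limsup_add_const atTop f _ (by isBoundedDefault) (by isBoundedDefault)]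
  refine limsup_le_limsup ?_
  filter_upwards [eventually_ge_atTop n] with m hm
  exact add_le_add_right (iInf₂_le m hm) _

/-- Excess of `f` over `a` in the limit would have to be compensated by `g` falling below `b`: the
hypotheses give `limsup f + b ≤ a + b`, and the finite `b` cancels. -/
theorem tendsto_of_tendsto_add {f g : ℕ → ℝ≥0∞} {a b : ℝ≥0∞} (hf : a ≤ liminf f atTop)
    (hg : b ≤ liminf g atTop) (hb : b ≠ ∞)
    (h : Tendsto (fun n => f n + g n) atTop (𝓝 (a + b))) : Tendsto f atTop (𝓝 a) := by
  refine tendsto_of_le_liminf_of_limsup_le hf ?_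
  have h1 : limsup f atTop + b ≤ a + b :=
    (add_le_add_right hg _).trans ((limsup_add_liminf_le_limsup_add f g).trans h.limsup_eq.le)
  exact (ENNReal.add_le_add_iff_right hb).mp h1

theorem tendsto_of_tendsto_const_mul {c : ℝ≥0∞} (hc : c ≠ 0) (hc' : c ≠ ∞) {f : ℕ → ℝ≥0∞}
    {a : ℝ≥0∞} (h : Tendsto (fun n => c * f n) atTop (𝓝 (c * a))) : Tendsto f atTop (𝓝 a) := by
  have := ENNReal.Tendsto.const_mul (a := c⁻¹) h (Or.inr (ENNReal.inv_ne_top.mpr hc))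
  simpa only [← mul_assoc, ENNReal.inv_mul_cancel hc hc', one_mul] using this

theorem const_mul_le_liminf {c : ℝ≥0∞} (hc : c ≠ 0) (hc' : c ≠ ∞) {f : ℕ → ℝ≥0∞}
    {a : ℝ≥0∞} (h : a ≤ liminf f atTop) : c * a ≤ liminf (fun n => c * f n) atTop := by
  rw [ENNReal.liminf_const_mul_of_ne_zero_of_ne_top hc hc']
  gcongr

end LowerLimits

/-! ### Γ-convergence, equi-coercivity modulo shifts, and stability of minimizers. -/

section Stability

variable {E Y : Type*} [NormedAddCommGroup E] [NormedSpace ℝ E] [NormedAddCommGroup Y]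
  [NormedSpace ℝ Y]

theorem WeakTendsto.map (A : E →L[ℝ] Y) {x : ℕ → E} {x₀ : E} (h : WeakTendsto x x₀) :
    WeakTendsto (fun n => A (x n)) (A x₀) := fun f => h (f.comp A)

theorem WeakTendsto.sub {x z : ℕ → E} {x₀ z₀ : E} (hx : WeakTendsto x x₀)
    (hz : WeakTendsto z z₀) : WeakTendsto (fun n => x n - z n) (x₀ - z₀) := fun f => by
  simpa only [map_sub] using (hx f).sub (hz f)

/-- The lower estimate is applied to a constant sequence. -/
theorem DataTendsto.tendsto {Dm : ℕ → Y → ℝ≥0∞} {D : Y → ℝ≥0∞} (h : DataTendsto Dm D) (z : Y) :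
    Tendsto (fun m => Dm m z) atTop (𝓝 (D z)) :=
  tendsto_of_le_liminf_of_limsup_le (h.le_liminf _ z fun _ => tendsto_const_nhds) (h.limsup_le z)

/-- The lower estimate along subsequences. -/
theorem DataTendsto.le_liminf_subseq {Dm : ℕ → Y → ℝ≥0∞} {D : Y → ℝ≥0∞} (h : DataTendsto Dm D)
    {k : ℕ → ℕ} (hk : StrictMono k) {z : ℕ → Y} {z₀ : Y} (hz : WeakTendsto z z₀) :
    D z₀ ≤ liminf (fun i => Dm (k i) (z i)) atTop := by
  -- The hypothesis concerns full sequences, so the gaps are filled with the limit. The filled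
  -- sequence still converges weakly, and its lower limit is at most the one along `k`.
  let z' : ℕ → Y := Function.extend k z fun _ => z₀
  have hz' : ∀ i, z' (k i) = z i := fun i => hk.injective.extend_apply _ _ i
  have hw : WeakTendsto z' z₀ := by
    intro f
    refine tendsto_def.mpr fun s hs => ?_
    obtain ⟨I, hI⟩ := eventually_atTop.mp ((hz f).eventually_mem hs)
    refine mem_atTop_sets.mpr ⟨k I, fun m hm => ?_⟩
    rw [Set.mem_preimage]
    by_cases hex : ∃ i, k i = m
    · obtain ⟨i, rfl⟩ := hex
      rw [hz']
      exact hI i (hk.le_iff_le.mp hm)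
    · rw [show z' m = z₀ from Function.extend_apply' _ _ _ hex]
      exact mem_of_mem_nhds hs
  refine (h.le_liminf z' z₀ hw).trans ?_
  refine (liminf_le_liminf_of_le (g := map k atTop) hk.tendsto_atTop).trans (le_of_eq ?_)
  change liminf (fun i => Dm (k i) (z' (k i))) atTop = _
  simp only [hz']

theorem Coercive.exists_bound {E : Type*} [NormedAddCommGroup E] {F : E → ℝ≥0∞} (hF : Coercive F) {M : ℝ≥0∞} (hM : M ≠ ∞) :
    ∃ B : ℝ, ∀ z, F z ≤ M → ‖z‖ ≤ B := by
  have h : ∀ᶠ z in Bornology.cobounded E, M < F z :=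
    hF.eventually (lt_mem_nhds hM.lt_top)
  obtain ⟨B, -, hB⟩ := (hasBasis_cobounded_norm (E := E)).eventually_iff.mp h
  refine ⟨B, fun z hz => ?_⟩
  by_contra! hlt
  exact absurd (hB hlt.le) (not_lt.mpr hz)

/-- Reduces both alternatives of the kernel condition to one. If `U` is finite dimensional, `A` is
injective on a complement of `U ∩ ker A` in `U`, hence bounded below there. -/
theorem exists_complement_bound {A : E →L[ℝ] Y} {R : E → ℝ≥0∞} {U : Submodule ℝ E}
    (hR : RegularizerAssumption A R U) :
    ∃ V : Submodule ℝ E, V ⊔ (U ⊓ LinearMap.ker A.toLinearMap) = U ∧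
      ∃ c : ℝ, 0 < c ∧ ∀ u ∈ V, ‖u‖ ≤ c * ‖A u‖ := by
  rcases hR.kernel with hfin | ⟨V, -, -, hV, hc⟩
  · obtain ⟨V', hV'⟩ := Submodule.exists_isCompl (U ⊓ LinearMap.ker A.toLinearMap)
    have hfd : FiniteDimensional ℝ (V' ⊓ U : Submodule ℝ E) :=
      Submodule.finiteDimensional_of_le inf_le_right
    have hker : LinearMap.ker (A.toLinearMap.domRestrict (V' ⊓ U)) = ⊥ := by
      rw [LinearMap.ker_eq_bot']
      intro x hx
      have hmem : (x : E) ∈ (U ⊓ LinearMap.ker A.toLinearMap) ⊓ V' :=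
        ⟨⟨x.2.2, hx⟩, x.2.1⟩
      rw [hV'.inf_eq_bot, Submodule.mem_bot] at hmem
      exact Subtype.ext hmem
    obtain ⟨c, hc, h⟩ := LinearMap.exists_antilipschitzWith _ hker
    refine ⟨V' ⊓ U, ?_, c, hc, fun u hu => ?_⟩
    -- The modular law: a complement in the whole space, intersected with `U`, is a complement in
    -- `U`.
    · rw [sup_comm, ← sup_inf_assoc_of_le V' (inf_le_left : U ⊓ _ ≤ U), hV'.sup_eq_top, top_inf_eq]
    · exact ZeroHomClass.bound_of_antilipschitz (A.toLinearMap.domRestrict (V' ⊓ U)) h ⟨u, hu⟩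
  · exact ⟨V, hV, hc⟩

/-- Every element can be shifted along `U ∩ ker A` such that its norm is controlled. -/
theorem exists_shift {A : E →L[ℝ] Y} {U : Submodule ℝ E} {V : Submodule ℝ E}
    (hV : V ⊔ (U ⊓ LinearMap.ker A.toLinearMap) = U) {c : ℝ} (hc : 0 < c)
    (hVc : ∀ u ∈ V, ‖u‖ ≤ c * ‖A u‖) {P : E →L[ℝ] E} (hP : ∀ u, P u ∈ U) (u : E) :
    ∃ w, (w ∈ U ∧ A w = 0) ∧ ‖u + w‖ ≤ (1 + c * ‖A‖) * ‖u - P u‖ + c * ‖A u‖ := by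
  have hPu := hP u
  rw [← hV] at hPu
  -- Split `P u = a + b` with `a ∈ V` and `b ∈ U ∩ ker A`. The shift by `-b` leaves `(u - P u) + a`,
  -- and `A a = A u - A (u - P u)` controls `a`.
  obtain ⟨a, ha, b, hb, hab⟩ := Submodule.mem_sup.mp hPu
  have hAb : A b = 0 := hb.2
  refine ⟨-b, ⟨U.neg_mem hb.1, by rw [map_neg, hAb, neg_zero]⟩, ?_⟩
  have h1 : u + -b = (u - P u) + a := by rw [← hab]; abel
  have h2 : A a = A u - A (u - P u) := by
    rw [map_sub, ← hab, map_add, hAb]; abel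
  have h3 : ‖a‖ ≤ c * (‖A u‖ + ‖A‖ * ‖u - P u‖) := by
    refine (hVc a ha).trans ?_
    rw [h2]
    gcongr
    exact (norm_sub_le _ _).trans (by gcongr; exact A.le_opNorm _)
  rw [h1]
  refine (norm_add_le _ _).trans ?_
  linarith

theorem weightR_pos {ν : ℝ} (h0 : 0 < ν) (h1 : ν < 1) : 0 < weightR ν :=
  div_pos h0 (lt_min h0 (sub_pos.mpr h1))

theorem weightG_pos {ν : ℝ} (h0 : 0 < ν) (h1 : ν < 1) : 0 < weightG ν :=
  div_pos (sub_pos.mpr h1) (lt_min h0 (sub_pos.mpr h1))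

theorem energy_shift {lam ν : ℝ} {A : E →L[ℝ] Y} {D : Y → ℝ≥0∞} {R G : E → ℝ≥0∞}
    {U : Submodule ℝ E} (hR : RegularizerAssumption A R U) {w : E} (hw : w ∈ U ∧ A w = 0)
    (u v : E) : energy lam ν A D R G (u + w) v = energy lam ν A D R G u v := by
  rw [energy, energy, map_add, hw.2, add_zero, add_sub_right_comm, ← hR.invariant _ w hw.1]

theorem le_of_mul_le_ofReal {c : ℝ} (hc : 0 < c) {x M : ℝ≥0∞} (h : ENNReal.ofReal c * x ≤ M) :
    x ≤ M / ENNReal.ofReal c := by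
  rw [ENNReal.le_div_iff_mul_le (Or.inl (ENNReal.ofReal_pos.mpr hc).ne')
    (Or.inl ENNReal.ofReal_ne_top), mul_comm]
  exact h

theorem norm_le_toReal_of_enorm_le {E : Type*} [NormedAddCommGroup E] {x : E} {C : ℝ≥0} {a b : ℝ≥0∞} (h : ‖x‖ₑ ≤ C * a)
    (hab : a ≤ b) (hb : b ≠ ∞) : ‖x‖ ≤ (C * b).toReal := by
  rw [← toReal_enorm]
  exact ENNReal.toReal_mono (ENNReal.mul_ne_top ENNReal.coe_ne_top hb) (h.trans (by gcongr))

/-- Up to shifts along `U ∩ ker A`, the sublevel sets of the energies are uniformly bounded. -/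
theorem exists_shift_bound {lam ν : ℝ} (hlam : 0 < lam) (hν₀ : 0 < ν) (hν₁ : ν < 1)
    {A : E →L[ℝ] Y} {Dm : ℕ → Y → ℝ≥0∞} {R G : E → ℝ≥0∞} {U : Submodule ℝ E}
    (hR : RegularizerAssumption A R U) (hcoer : EquiCoercive Dm)
    (hG : ∃ C : ℝ≥0, ∀ v, ‖v‖ₑ ≤ C * G v) :
    ∃ w : E → E, (∀ u, w u ∈ U ∧ A (w u) = 0) ∧ ∀ M : ℝ≥0∞, M ≠ ∞ → ∃ B : ℝ, ∀ m u v,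
      energy lam ν A (Dm m) R G u v ≤ M → ‖u + w u‖ ≤ B ∧ ‖v‖ ≤ B := by
  obtain ⟨V, hV, c, hc, hVc⟩ := exists_complement_bound hR
  obtain ⟨P, hPU, -, C, -, hC⟩ := hR.projection
  obtain ⟨CG, hCG⟩ := hG
  obtain ⟨D₀, hD₀, hle⟩ := hcoer
  -- The shift depends on `u` alone, so the same one serves every `m` and every energy level.
  choose w hw hwb using exists_shift hV hc hVc hPU
  refine ⟨w, hw, fun M hM => ?_⟩
  have hfin : ∀ {s : ℝ}, 0 < s → M / ENNReal.ofReal s ≠ ∞ := fun hs =>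
    ENNReal.div_ne_top hM (ENNReal.ofReal_pos.mpr hs).ne'
  obtain ⟨BD, hBD⟩ := hD₀.exists_bound (hfin hlam)
  set BG : ℝ := (CG * (M / ENNReal.ofReal (weightG ν))).toReal
  set BR : ℝ := (C * (M / ENNReal.ofReal (weightR ν))).toReal
  -- `BD` bounds `A u`, `BG` bounds `v`, and `BR` bounds `u - v` minus its projection. The
  -- regularizer only sees `u - v`, so passing to `u - P u` costs the norm of `v - P v`, at most `BG
  -- + ‖P‖ * BG`.
  refine ⟨max ((1 + c * ‖A‖) * (BR + (BG + ‖P‖ * BG)) + c * BD) BG, fun m u v h => ?_⟩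
  have hD : D₀ (A u) ≤ M / ENNReal.ofReal lam :=
    (hle m _).trans (le_of_mul_le_ofReal hlam ((le_self_add.trans le_self_add).trans h))
  have hRb : R (u - v) ≤ M / ENNReal.ofReal (weightR ν) :=
    le_of_mul_le_ofReal (weightR_pos hν₀ hν₁) ((le_add_self.trans le_self_add).trans h)
  have hGb : G v ≤ M / ENNReal.ofReal (weightG ν) :=
    le_of_mul_le_ofReal (weightG_pos hν₀ hν₁) (le_add_self.trans h)
  have h1 : ‖A u‖ ≤ BD := hBD _ hD
  have h2 : ‖v‖ ≤ BG := norm_le_toReal_of_enorm_le (hCG v) hGb (hfin (weightG_pos hν₀ hν₁))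
  have h3 : ‖(u - v) - P (u - v)‖ ≤ BR :=
    norm_le_toReal_of_enorm_le (hC _) hRb (hfin (weightR_pos hν₀ hν₁))
  have h4 : ‖u - P u‖ ≤ BR + (BG + ‖P‖ * BG) := by
    have : u - P u = ((u - v) - P (u - v)) + (v - P v) := by rw [map_sub]; abel
    rw [this]
    refine (norm_add_le _ _).trans (add_le_add h3 ((norm_sub_le _ _).trans (add_le_add h2 ?_)))
    exact (P.le_opNorm v).trans (by gcongr)
  refine ⟨le_max_of_le_left ((hwb u).trans ?_), le_max_of_le_right h2⟩
  gcongr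

/-- The energies are lower semicontinuous along weakly convergent subsequences. -/
theorem energy_le_liminf {lam ν : ℝ} (hlam : 0 < lam) (hν₀ : 0 < ν) (hν₁ : ν < 1)
    {A : E →L[ℝ] Y} {Dm : ℕ → Y → ℝ≥0∞} {D : Y → ℝ≥0∞} {R G : E → ℝ≥0∞} {U : Submodule ℝ E}
    (hR : RegularizerAssumption A R U) (hconv : DataTendsto Dm D)
    (hG : ∀ (v : ℕ → E) (v₀ : E), WeakTendsto v v₀ → G v₀ ≤ liminf (fun m => G (v m)) atTop)
    {k : ℕ → ℕ} (hk : StrictMono k) {u v : ℕ → E} {u₀ v₀ : E} (hu : WeakTendsto u u₀)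
    (hv : WeakTendsto v v₀) :
    energy lam ν A D R G u₀ v₀
      ≤ liminf (fun i => energy lam ν A (Dm (k i)) R G (u i) (v i)) atTop := by
  have hpos : ∀ {s : ℝ}, 0 < s → ENNReal.ofReal s ≠ 0 := fun hs => (ENNReal.ofReal_pos.mpr hs).ne'
  refine le_trans (add_le_add (le_trans (add_le_add ?_ ?_) (add_liminf_le_liminf_add _ _)) ?_)
    (add_liminf_le_liminf_add _ _)
  · exact const_mul_le_liminf (hpos hlam) ENNReal.ofReal_ne_top
      (hconv.le_liminf_subseq hk (hu.map A))
  · exact const_mul_le_liminf (hpos (weightR_pos hν₀ hν₁)) ENNReal.ofReal_ne_top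
      (hR.weak_lsc _ _ (hu.sub hv))
  · exact const_mul_le_liminf (hpos (weightG_pos hν₀ hν₁)) ENNReal.ofReal_ne_top (hG _ _ hv)

/-- If the energies converge along a weakly convergent subsequence, so do all of their terms. -/
theorem tendsto_terms_of_tendsto_energy {lam ν : ℝ} (hlam : 0 < lam) (hν₀ : 0 < ν) (hν₁ : ν < 1)
    {A : E →L[ℝ] Y} {Dm : ℕ → Y → ℝ≥0∞} {D : Y → ℝ≥0∞} {R G : E → ℝ≥0∞} {U : Submodule ℝ E}
    (hR : RegularizerAssumption A R U) (hconv : DataTendsto Dm D)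
    (hG : ∀ (v : ℕ → E) (v₀ : E), WeakTendsto v v₀ → G v₀ ≤ liminf (fun m => G (v m)) atTop)
    {k : ℕ → ℕ} (hk : StrictMono k) {u v : ℕ → E} {u₀ v₀ : E} (hu : WeakTendsto u u₀)
    (hv : WeakTendsto v v₀) (hfin : energy lam ν A D R G u₀ v₀ ≠ ∞)
    (h : Tendsto (fun i => energy lam ν A (Dm (k i)) R G (u i) (v i)) atTop
      (𝓝 (energy lam ν A D R G u₀ v₀))) :
    Tendsto (fun i => Dm (k i) (A (u i))) atTop (𝓝 (D (A u₀))) ∧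
      Tendsto (fun i => R (u i - v i)) atTop (𝓝 (R (u₀ - v₀))) ∧
      Tendsto (fun i => G (v i)) atTop (𝓝 (G v₀)) := by
  have hpos : ∀ {s : ℝ}, 0 < s → ENNReal.ofReal s ≠ 0 := fun hs => (ENNReal.ofReal_pos.mpr hs).ne'
  have h1 := const_mul_le_liminf (hpos hlam) ENNReal.ofReal_ne_top
    (hconv.le_liminf_subseq hk (hu.map A))
  have h2 := const_mul_le_liminf (hpos (weightR_pos hν₀ hν₁)) ENNReal.ofReal_ne_top
    (hR.weak_lsc _ _ (hu.sub hv))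
  have h3 := const_mul_le_liminf (hpos (weightG_pos hν₀ hν₁)) ENNReal.ofReal_ne_top (hG _ _ hv)
  unfold energy at h hfin
  have h12 := (add_le_add h1 h2).trans (add_liminf_le_liminf_add _ _)
  have hf := ENNReal.add_ne_top.mp hfin
  have hf' := ENNReal.add_ne_top.mp hf.1
  have t12 := tendsto_of_tendsto_add h12 h3 hf.2 h
  refine ⟨?_, ?_, ?_⟩
  · exact tendsto_of_tendsto_const_mul (hpos hlam) ENNReal.ofReal_ne_top
      (tendsto_of_tendsto_add h1 h2 hf'.2 t12)
  · refine tendsto_of_tendsto_const_mul (hpos (weightR_pos hν₀ hν₁)) ENNReal.ofReal_ne_top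
      (tendsto_of_tendsto_add h2 h1 hf'.1 ?_)
    simpa only [add_comm] using t12
  · refine tendsto_of_tendsto_const_mul (hpos (weightG_pos hν₀ hν₁)) ENNReal.ofReal_ne_top
      (tendsto_of_tendsto_add h3 h12 hf.1 ?_)
    rw [add_comm]
    simpa only [add_comm] using h

/-- Constant sequences are recovery sequences: only the data term depends on `m`, and its weight is
finite, so the product converges even where the limit is infinite. -/
theorem tendsto_energy {lam ν : ℝ} {A : E →L[ℝ] Y} {Dm : ℕ → Y → ℝ≥0∞} {D : Y → ℝ≥0∞}
    {R G : E → ℝ≥0∞} (hconv : DataTendsto Dm D) (u v : E) :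
    Tendsto (fun m => energy lam ν A (Dm m) R G u v) atTop (𝓝 (energy lam ν A D R G u v)) :=
  ((ENNReal.Tendsto.const_mul (hconv.tendsto (A u)) (Or.inr ENNReal.ofReal_ne_top)).add
    tendsto_const_nhds).add tendsto_const_nhds

/-- Stability of minimizers in a normed space with weakly sequentially compact balls. -/
theorem stability {lam ν : ℝ} (hlam : 0 < lam) (hν₀ : 0 < ν) (hν₁ : ν < 1)
    (hcpt : ∀ (f : ℕ → E) (C : ℝ), (∀ n, ‖f n‖ ≤ C) →
      ∃ g, ∃ k : ℕ → ℕ, StrictMono k ∧ WeakTendsto (fun n => f (k n)) g)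
    {A : E →L[ℝ] Y} {Dm : ℕ → Y → ℝ≥0∞} {D : Y → ℝ≥0∞} {R G : E → ℝ≥0∞} {U : Submodule ℝ E}
    (hR : RegularizerAssumption A R U) (hconv : DataTendsto Dm D) (hcoer : EquiCoercive Dm)
    (hG : ∀ (v : ℕ → E) (v₀ : E), WeakTendsto v v₀ → G v₀ ≤ liminf (fun m => G (v m)) atTop)
    (hGc : ∃ C : ℝ≥0, ∀ v, ‖v‖ₑ ≤ C * G v)
    (u v : ℕ → E) (hmin : ∀ m, IsMinimizer (energy lam ν A (Dm m) R G) (u m) (v m)) :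
    (Tendsto (fun m => energy lam ν A (Dm m) R G (u m) (v m)) atTop (𝓝 ⊤) ∧
      ∀ u' v', energy lam ν A D R G u' v' = ⊤) ∨
    ((∃ u₀ v₀, IsMinimizer (energy lam ν A D R G) u₀ v₀ ∧ energy lam ν A D R G u₀ v₀ < ⊤ ∧
        Tendsto (fun m => energy lam ν A (Dm m) R G (u m) (v m)) atTop
          (𝓝 (energy lam ν A D R G u₀ v₀))) ∧
      (∃ w : ℕ → E, (∀ m, w m ∈ U ∧ A (w m) = 0) ∧
        ∃ k : ℕ → ℕ, StrictMono k ∧ ∃ u₀ v₀, WeakTendsto (fun i => u (k i) + w (k i)) u₀ ∧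
          WeakTendsto (fun i => v (k i)) v₀ ∧ IsMinimizer (energy lam ν A D R G) u₀ v₀) ∧
      (∀ w : ℕ → E, (∀ m, w m ∈ U ∧ A (w m) = 0) →
        ∀ k : ℕ → ℕ, StrictMono k → ∀ u₀ v₀, WeakTendsto (fun i => u (k i) + w (k i)) u₀ →
          WeakTendsto (fun i => v (k i)) v₀ →
          IsMinimizer (energy lam ν A D R G) u₀ v₀ ∧
          Tendsto (fun i => Dm (k i) (A (u (k i)))) atTop (𝓝 (D (A u₀))) ∧
          Tendsto (fun i => R (u (k i) - v (k i))) atTop (𝓝 (R (u₀ - v₀))) ∧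
          Tendsto (fun i => G (v (k i))) atTop (𝓝 (G v₀))) ∧
      (∀ u₀ v₀, IsMinimizer (energy lam ν A D R G) u₀ v₀ →
        (∀ u' v', IsMinimizer (energy lam ν A D R G) u' v' → u' = u₀ ∧ v' = v₀) →
        WeakTendsto u u₀ ∧ WeakTendsto v v₀)) := by
  set F := energy lam ν A D R G with hF
  set e : ℕ → ℝ≥0∞ := fun m => energy lam ν A (Dm m) R G (u m) (v m) with he
  obtain ⟨w, hw, hwb⟩ := exists_shift_bound (ν := ν) hlam hν₀ hν₁ hR hcoer hGc
  have hshift : ∀ {m : ℕ} {w' : E}, w' ∈ U ∧ A w' = 0 →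
      energy lam ν A (Dm m) R G (u m + w') (v m) = e m := fun hw' => energy_shift hR hw' _ _
  have hlow : ∀ {w' : ℕ → E}, (∀ m, w' m ∈ U ∧ A (w' m) = 0) → ∀ {k : ℕ → ℕ}, StrictMono k →
      ∀ {u₀ v₀}, WeakTendsto (fun i => u (k i) + w' (k i)) u₀ → WeakTendsto (fun i => v (k i)) v₀ →
      F u₀ v₀ ≤ liminf (fun i => e (k i)) atTop := by
    intro w' hw' k hk u₀ v₀ hu₀ hv₀
    have := energy_le_liminf hlam hν₀ hν₁ hR hconv hG hk hu₀ hv₀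
    simpa only [hshift (hw' _)] using this
  -- Cluster points minimize: the liminf inequality is combined with a fixed competitor, whose
  -- energies converge.
  have hclus : ∀ {w' : ℕ → E}, (∀ m, w' m ∈ U ∧ A (w' m) = 0) → ∀ {k : ℕ → ℕ}, StrictMono k →
      ∀ {u₀ v₀}, WeakTendsto (fun i => u (k i) + w' (k i)) u₀ → WeakTendsto (fun i => v (k i)) v₀ →
      IsMinimizer F u₀ v₀ := by
    intro w' hw' k hk u₀ v₀ hu₀ hv₀ u' v'
    have ht := (tendsto_energy (lam := lam) (ν := ν) (A := A) (R := R) (G := G)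
      hconv u' v').comp hk.tendsto_atTop
    refine (hlow hw' hk hu₀ hv₀).trans (le_trans ?_ ht.liminf_eq.le)
    exact liminf_le_liminf (Eventually.of_forall fun i => hmin (k i) u' v')
  have hex : ∀ {M : ℝ≥0∞}, M ≠ ∞ → ∀ {k : ℕ → ℕ}, (∀ i, e (k i) ≤ M) →
      ∃ k' : ℕ → ℕ, StrictMono k' ∧ ∃ u₀ v₀,
        WeakTendsto (fun i => u (k (k' i)) + w (u (k (k' i)))) u₀ ∧
        WeakTendsto (fun i => v (k (k' i))) v₀ := by
    intro M hM k hkM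
    obtain ⟨B, hB⟩ := hwb M hM
    obtain ⟨u₀, k₁, hk₁, hu₀⟩ := hcpt (fun i => u (k i) + w (u (k i))) B
      fun i => (hB _ _ _ (hkM i)).1
    obtain ⟨v₀, k₂, hk₂, hv₀⟩ := hcpt (fun i => v (k (k₁ i))) B fun i => (hB _ _ _ (hkM _)).2
    exact ⟨k₁ ∘ k₂, hk₁.comp hk₂, u₀, v₀, hu₀.comp_strictMono hk₂, hv₀⟩
  by_cases hfinite : ∀ u' v', F u' v' = ⊤
  · refine Or.inl ⟨?_, hfinite⟩
    rw [ENNReal.tendsto_nhds_top_iff_nnreal]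
    -- Otherwise a subsequence of optimal values is bounded, and its cluster point would have finite
    -- limit energy.
    by_contra! hcon
    obtain ⟨x, hx⟩ := hcon
    obtain ⟨k, hk, hkx⟩ := extraction_of_frequently_atTop hx
    have hkx' : ∀ i, e (k i) ≤ x := fun i => hkx i
    obtain ⟨k', hk', u₀, v₀, hu₀, hv₀⟩ := hex ENNReal.coe_ne_top hkx'
    have h1 := hlow (w' := fun m => w (u m)) (fun m => hw _) (hk.comp hk') hu₀ hv₀
    have h2 : liminf (fun i => e ((k ∘ k') i)) atTop ≤ x :=
      liminf_le_of_le (by isBoundedDefault) fun b hb => by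
        obtain ⟨i, hi⟩ := hb.exists
        exact hi.trans (hkx' _)
    rw [hfinite] at h1
    exact absurd (h1.trans h2) (by simp)
  · right
    push Not at hfinite
    obtain ⟨u₁, v₁, h₁⟩ := hfinite
    -- Any competitor of finite limit energy eventually bounds the optimal values.
    have hev : ∀ᶠ m in atTop, e m ≤ F u₁ v₁ + 1 := by
      have hlt : F u₁ v₁ < F u₁ v₁ + 1 := ENNReal.lt_add_right h₁ one_ne_zero
      filter_upwards [(tendsto_energy (lam := lam) (ν := ν) (A := A) (R := R) (G := G)
        hconv u₁ v₁).eventually (gt_mem_nhds hlt)] with m hm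
      exact (hmin m u₁ v₁).trans hm.le
    have hsub : ∀ {k : ℕ → ℕ}, StrictMono k → ∃ k' : ℕ → ℕ, StrictMono k' ∧ ∃ u₀ v₀,
        WeakTendsto (fun i => u (k (k' i)) + w (u (k (k' i)))) u₀ ∧
        WeakTendsto (fun i => v (k (k' i))) v₀ := by
      intro k hk
      obtain ⟨N, hN⟩ := eventually_atTop.mp hev
      obtain ⟨k', hk', h⟩ := hex (ENNReal.add_ne_top.mpr ⟨h₁, ENNReal.one_ne_top⟩)
        -- The bound holds only from `N` on; as `k` is strictly increasing, `k (i + N) ≥ N`.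
        (k := fun i => k (i + N)) fun i => hN _ ((Nat.le_add_left N i).trans (hk.le_apply))
      exact ⟨fun i => k' i + N, fun i j hij => Nat.add_lt_add_right (hk' hij) N, h⟩
    obtain ⟨k₀, hk₀, u₀, v₀, hu₀, hv₀⟩ := hsub strictMono_id
    have hmin₀ : IsMinimizer F u₀ v₀ :=
      hclus (w' := fun m => w (u m)) (fun m => hw _) hk₀ hu₀ hv₀
    have hfin₀ : F u₀ v₀ ≠ ⊤ := ((hmin₀ u₁ v₁).trans_lt h₁.lt_top).ne
    -- From below: a subsequence staying at or below some `b < F u₀ v₀` would have a cluster point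
    -- of energy at most `b`. From above: `(u₀, v₀)` itself is a competitor.
    have hlim : Tendsto e atTop (𝓝 (F u₀ v₀)) := by
      refine tendsto_order.mpr ⟨fun b hb => ?_, fun b hb => ?_⟩
      · by_contra hcon
        rw [not_eventually] at hcon
        obtain ⟨k, hk, hkx⟩ := extraction_of_frequently_atTop hcon
        obtain ⟨k', hk', u₂, v₂, hu₂, hv₂⟩ := hsub hk
        have h1 := hlow (w' := fun m => w (u m)) (fun m => hw _) (hk.comp hk') hu₂ hv₂
        have h2 : liminf (fun i => e ((k ∘ k') i)) atTop ≤ b :=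
          liminf_le_of_le (by isBoundedDefault) fun c hc => by
            obtain ⟨i, hi⟩ := hc.exists
            exact hi.trans (not_lt.mp (hkx _))
        exact absurd ((hmin₀ u₂ v₂).trans (h1.trans h2)) (not_le.mpr hb)
      · filter_upwards [(tendsto_energy (lam := lam) (ν := ν) (A := A) (R := R) (G := G)
          hconv u₀ v₀).eventually (gt_mem_nhds hb)] with m hm
        exact (hmin m u₀ v₀).trans_lt hm
    refine ⟨⟨u₀, v₀, hmin₀, hfin₀.lt_top, hlim⟩,
      ⟨fun m => w (u m), fun m => hw _, k₀, hk₀, u₀, v₀, hu₀, hv₀, hmin₀⟩, ?_, ?_⟩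
    · intro w' hw' k hk u₂ v₂ hu₂ hv₂
      have hmin₂ := hclus hw' hk hu₂ hv₂
      have heq : F u₂ v₂ = F u₀ v₀ := le_antisymm (hmin₂ _ _) (hmin₀ _ _)
      have ht : Tendsto (fun i => energy lam ν A (Dm (k i)) R G (u (k i) + w' (k i)) (v (k i)))
          atTop (𝓝 (F u₂ v₂)) := by
        simp only [hshift (hw' _), heq]
        exact hlim.comp hk.tendsto_atTop
      obtain ⟨t1, t2, t3⟩ := tendsto_terms_of_tendsto_energy hlam hν₀ hν₁ hR hconv hG hk hu₂ hv₂
        (ne_of_eq_of_ne heq hfin₀) ht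
      refine ⟨hmin₂, ?_, ?_, t3⟩
      · simpa only [map_add, (hw' _).2, add_zero] using t1
      · simpa only [add_sub_right_comm, ← hR.invariant _ _ (hw' _).1] using t2
    · intro u₂ v₂ hmin₂ huniq
      -- A shift of a minimizer is again a minimizer, so uniqueness forces every chosen shift to
      -- vanish, and compactness holds for the unshifted sequence.
      have hw0 : ∀ x, w x = 0 := by
        intro x
        have : IsMinimizer F (u₂ + w x) v₂ := fun u' v' => by
          rw [hF, energy_shift hR (hw x)]
          exact hmin₂ u' v'
        simpa using (huniq _ _ this).1
      have key : ∀ k : ℕ → ℕ, StrictMono k → ∃ k' : ℕ → ℕ,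
          WeakTendsto (fun i => u (k (k' i))) u₂ ∧ WeakTendsto (fun i => v (k (k' i))) v₂ := by
        intro k hk
        obtain ⟨k', hk', u₃, v₃, hu₃, hv₃⟩ := hsub hk
        obtain ⟨rfl, rfl⟩ := huniq _ _ (hclus (w' := fun m => w (u m)) (fun m => hw _)
          (hk.comp hk') hu₃ hv₃)
        simp only [hw0, add_zero] at hu₃
        exact ⟨k', hu₃, hv₃⟩
      constructor
      · intro f
        -- The sequence `ns` need not be monotone, so it is thinned to a strictly increasing one
        -- before `key` applies.
        refine tendsto_of_subseq_tendsto fun ns hns => ?_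
        obtain ⟨φ, hφ, hmono⟩ := strictMono_subseq_of_tendsto_atTop hns
        obtain ⟨k', h, -⟩ := key _ hmono
        exact ⟨φ ∘ k', h f⟩
      · intro f
        refine tendsto_of_subseq_tendsto fun ns hns => ?_
        obtain ⟨φ, hφ, hmono⟩ := strictMono_subseq_of_tendsto_atTop hns
        obtain ⟨k', -, h⟩ := key _ hmono
        exact ⟨φ ∘ k', h f⟩

end Stability

end StableGen

end

theorem mainTheorem2 {d : ℕ} (X : StableGen.Geometry d) (a : StableGen.Architecture)
    (q : ℝ≥0∞) [Fact (1 ≤ q)] (hq₁ : 1 < q) (hq₂ : q ≤ 2)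
    {Y : Type*} [NormedAddCommGroup Y] [NormedSpace ℝ Y] [CompleteSpace Y]
    (A : StableGen.LpOn q X.Ω →L[ℝ] Y)
    (lam ν : ℝ) (hlam : 0 < lam) (hν₀ : 0 < ν) (hν₁ : ν < 1)
    (D : Y → Y → ℝ≥0∞) (y : Y) (ym : ℕ → Y)
    {Nc : ℕ} (Z : StableGen.Kernels X a →L[ℝ] (Fin Nc → ℝ))
    (J : (j : Fin a.depth) → StableGen.LatentLayer X a ((j : ℕ) + 1) → ℝ≥0∞)
    (R : StableGen.LpOn q X.Ω → ℝ≥0∞) (U : Submodule ℝ (StableGen.LpOn q X.Ω))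
    (hD : StableGen.DataTermAssumption (D y))
    (hJ : StableGen.PenaltyAssumption J)
    (hR : StableGen.RegularizerAssumption A R U)
    (hconv : StableGen.DataTendsto (fun m => D (ym m)) (D y))
    (hcoer : StableGen.EquiCoercive (fun m => D (ym m)))
    (u v : ℕ → StableGen.LpOn q X.Ω)
    (hmin : ∀ m, StableGen.IsMinimizer
      (StableGen.energy lam ν A (D (ym m)) R (StableGen.genPrior Z J)) (u m) (v m)) :
    (Tendsto (fun m => StableGen.energy lam ν A (D (ym m)) R (StableGen.genPrior Z J) (u m) (v m))
        atTop (𝓝 ⊤) ∧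
      ∀ u' v', StableGen.energy lam ν A (D y) R (StableGen.genPrior Z J) u' v' = ⊤) ∨
    -- the optimal energies converge to a finite minimum, which is attained
    ((∃ u₀ v₀, StableGen.IsMinimizer
          (StableGen.energy lam ν A (D y) R (StableGen.genPrior Z J)) u₀ v₀ ∧
        StableGen.energy lam ν A (D y) R (StableGen.genPrior Z J) u₀ v₀ < ⊤ ∧
        Tendsto
          (fun m => StableGen.energy lam ν A (D (ym m)) R (StableGen.genPrior Z J) (u m) (v m))
          atTop (𝓝 (StableGen.energy lam ν A (D y) R (StableGen.genPrior Z J) u₀ v₀))) ∧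
      -- up to shifts, a weak accumulation point exists that is a minimizer
      (∃ w : ℕ → StableGen.LpOn q X.Ω, (∀ m, w m ∈ U ∧ A (w m) = 0) ∧
        ∃ k : ℕ → ℕ, StrictMono k ∧ ∃ u₀ v₀,
          StableGen.WeakTendsto (fun i => u (k i) + w (k i)) u₀ ∧
          StableGen.WeakTendsto (fun i => v (k i)) v₀ ∧
          StableGen.IsMinimizer
            (StableGen.energy lam ν A (D y) R (StableGen.genPrior Z J)) u₀ v₀) ∧
      -- every weakly convergent subsequence, possibly after shifts (`w = 0` is allowed)
      (∀ w : ℕ → StableGen.LpOn q X.Ω, (∀ m, w m ∈ U ∧ A (w m) = 0) →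
        ∀ k : ℕ → ℕ, StrictMono k → ∀ u₀ v₀,
          StableGen.WeakTendsto (fun i => u (k i) + w (k i)) u₀ →
          StableGen.WeakTendsto (fun i => v (k i)) v₀ →
          StableGen.IsMinimizer
            (StableGen.energy lam ν A (D y) R (StableGen.genPrior Z J)) u₀ v₀ ∧
          Tendsto (fun i => D (ym (k i)) (A (u (k i)))) atTop (𝓝 (D y (A u₀))) ∧
          Tendsto (fun i => R (u (k i) - v (k i))) atTop (𝓝 (R (u₀ - v₀))) ∧
          Tendsto (fun i => StableGen.genPrior Z J (v (k i))) atTop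
            (𝓝 (StableGen.genPrior Z J v₀))) ∧
      -- if the minimizer is unique, the whole sequence converges weakly to it
      (∀ u₀ v₀, StableGen.IsMinimizer
          (StableGen.energy lam ν A (D y) R (StableGen.genPrior Z J)) u₀ v₀ →
        (∀ u' v', StableGen.IsMinimizer
          (StableGen.energy lam ν A (D y) R (StableGen.genPrior Z J)) u' v' → u' = u₀ ∧ v' = v₀) →
        StableGen.WeakTendsto u u₀ ∧ StableGen.WeakTendsto v v₀)) := by
  have := StableGen.isFiniteMeasure_restrict X.domain_Ω.isBounded
  -- The prior enters only through its lower semicontinuity and its norm bound. The lower bound on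
  -- `q` serves compactness, the upper one places convolutions with square integrable kernels in
  -- L^q.
  exact StableGen.stability hlam hν₀ hν₁
    (StableGen.exists_subseq_weakTendsto_Lp hq₁ (ne_top_of_le_ne_top ENNReal.ofNat_ne_top hq₂))
    hR hconv hcoer (fun _ _ => StableGen.genPrior_le_liminf hq₂ Z hJ)
    (StableGen.exists_enorm_le_genPrior hq₂ Z J) u v hmin
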